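/- For a probability measure $\mu$ on a compact set $C\subset\mathbb R^n$ let $I(\mu)=\int\!\!\int\log\frac1{|x-y|}\,d\mu(x)\,d\mu(y)\in(-\infty,\infty]$. A set $A\subset\mathbb R^n$ is called log-polar if $I(\mu)=\infty$ for every compact $C\subset A$ and every probability measure $\mu$ on $C$. Let $K\subset\mathbb R^n$ be compact and not log-polar, and let $Q:K\to(-\infty,\infty]$ be admissible, i.e. lower semicontinuous with $\{x\in K:Q(x)<\infty\}$ not log-polar. Put $w=e^{-Q}$ and $$I^Q(\mu)=\int\!\!\int\log\frac1{|x-y|\,w(x)\,w(y)}\,d\mu(x)\,d\mu(y),\qquad V_w=\inf_\mu I^Q(\mu),$$ the infimum being over all probability measures $\mu$ on $K$. For $k\ge1$ let $$|VDM_k^Q(x_1,\dots,x_k)|=\prod_{1\le i<j\le k}|x_i-x_j|\,w(x_i)\,w(x_j),$$ and for a finite positive Borel measure $\nu$ on $K$ let $$Z_k^Q(K,\nu)=\int_{K^k}|VDM_k^Q|^2\,d\nu^{k},\qquad Prob_k=\frac{1}{Z_k^Q(K,\nu)}\,|VDM_k^Q|^2\,\nu^{k}.$$ The weighted diameters $\delta_k^Q(K)=\sup_{K^k}|VDM_k^Q|^{2/k(k-1)}$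 ($k\ge2$) converge as $k\to\infty$, and their limit is $\delta^Q(K)=e^{-V_w}$. There is a unique probability measure $\mu_{K,Q}$ on $K$ with $I^Q(\mu_{K,Q})=V_w$ (the weighted equilibrium measure). For every finite positive Borel measure $\nu$ on $K$ with $$\lim_{k\to\infty}\bigl(Z_k^Q(K,\nu)\bigr)^{1/k(k-1)}=e^{-V_w}=\delta^Q(K),$$ each $Prob_k$, $k\ge1$, is a well-defined probability measure on $K^k$, and for almost every array $X=\{x_j^{(k)}\}_{1\le j\le k,\ k\ge1}$ with respect to the product measure ${\bf P}=\prod_{k=1}^\infty Prob_k$ on $\prod_{k=1}^\infty K^k$, $$\frac1k\sum_{j=1}^k\delta_{x_j^{(k)}}\longrightarrow\mu_{K,Q}\quad\text{weakly as }k\to\infty.$$ -/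

import Mathlib

open MeasureTheory Filter Topology
open scoped ENNReal

namespace WeightedLogPotential

noncomputable section

/-- The extended integral `∫ f⁺ dμ - ∫ f⁻ dμ ∈ [-∞, ∞]` of an extended real function. It is the
usual integral whenever one of the two terms is finite; all integrands below are bounded from
below and all measures they are integrated against are finite, so the second term is finite. -/
def extIntegral {X : Type*} [MeasurableSpace X] (μ : Measure X) (f : X → EReal) : EReal :=
  ((∫⁻ x, (f x).toENNReal ∂μ : ℝ≥0∞) : EReal) - ((∫⁻ x, (-f x).toENNReal ∂μ : ℝ≥0∞) : EReal)

/-- The logarithmic energy `I(μ) = ∬ log (1 / |x - y|) dμ(x) dμ(y)`; the integrand is `∞` on the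
diagonal. -/
def logEnergy {X : Type*} [PseudoEMetricSpace X] [MeasurableSpace X] (μ : Measure X) : EReal :=
  extIntegral (μ.prod μ) fun p => -ENNReal.log (edist p.1 p.2)

/-- A subset of a metric space is log-polar if every probability measure on every compact subset of
it has infinite logarithmic energy. For a compact set it is equivalent to look at the probability
measures on the set itself. -/
def IsLogPolar {E : Type*} [PseudoEMetricSpace E] [MeasurableSpace E] (A : Set E) : Prop :=
  ∀ C : Set E, C ⊆ A → IsCompact C → ∀ μ : ProbabilityMeasure C, logEnergy (μ : Measure C) = ⊤

/-- Admissible weights `Q : K → (-∞, ∞]` on a compact set `K`: `K` is not log-polar, `Q` is lower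
semicontinuous, and `{Q < ∞}` is not log-polar. -/
structure Admissible {E : Type*} [PseudoEMetricSpace E] [MeasurableSpace E] (K : Set E)
    (Q : K → EReal) : Prop where
  isCompact : IsCompact K
  not_logPolar : ¬ IsLogPolar K
  ne_bot : ∀ x, Q x ≠ ⊥
  lowerSemicontinuous : LowerSemicontinuous Q
  not_logPolar_finite : ¬ IsLogPolar (Subtype.val '' {x : K | Q x < ⊤})

section

variable {X : Type*} [PseudoEMetricSpace X]

/-- `w(x) = exp (-Q(x))`, with `w(x) = 0` where `Q(x) = ∞`. -/
def weight (Q : X → EReal) (x : X) : ℝ≥0∞ := EReal.exp (-Q x)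

/-- The weighted Vandermonde `|VDM_k^Q(x)| = ∏_{i < j} |x_i - x_j| w(x_i) w(x_j)`. -/
def vdm (Q : X → EReal) {k : ℕ} (x : Fin k → X) : ℝ≥0∞ :=
  ∏ i : Fin k, ∏ j ∈ Finset.Ioi i, edist (x i) (x j) * weight Q (x i) * weight Q (x j)

/-- The `k`-th weighted diameter `δ_k^Q = sup_x |VDM_k^Q(x)| ^ (2 / (k (k - 1)))`, for `k ≥ 2`. -/
def diameter (Q : X → EReal) (k : ℕ) : ℝ≥0∞ :=
  ⨆ x : Fin k → X, vdm Q x ^ (2 / ((k : ℝ) * ((k : ℝ) - 1)))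

variable [MeasurableSpace X]

/-- The weighted energy `I^Q(μ) = ∬ log (1 / (|x - y| w(x) w(y))) dμ(x) dμ(y)`. -/
def weightedEnergy (Q : X → EReal) (μ : Measure X) : EReal :=
  extIntegral (μ.prod μ) fun p => -ENNReal.log (edist p.1 p.2 * weight Q p.1 * weight Q p.2)

/-- `V_w`, the infimum of the weighted energy over all probability measures. -/
def minEnergy (Q : X → EReal) : EReal :=
  ⨅ μ : ProbabilityMeasure X, weightedEnergy Q (μ : Measure X)

/-- `μ` is the unique probability measure whose weighted energy is `V_w`. -/
def IsEquilibriumMeasure (Q : X → EReal) (μ : ProbabilityMeasure X) : Prop :=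
  weightedEnergy Q (μ : Measure X) = minEnergy Q ∧
    ∀ μ' : ProbabilityMeasure X, weightedEnergy Q (μ' : Measure X) = minEnergy Q → μ' = μ

/-- The normalization constant `Z_k^Q = ∫ |VDM_k^Q(x)|² dν(x_1) ⋯ dν(x_k)`. -/
def partitionFunction (Q : X → EReal) (ν : Measure X) (k : ℕ) : ℝ≥0∞ :=
  ∫⁻ x : Fin k → X, vdm Q x ^ 2 ∂(Measure.pi fun _ => ν)

/-- The Vandermonde ensemble `Prob_k = |VDM_k^Q|² dν^k / Z_k^Q` on `k`-tuples of points. -/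
def vdmEnsemble (Q : X → EReal) (ν : Measure X) (k : ℕ) : Measure (Fin k → X) :=
  (partitionFunction Q ν k)⁻¹ • (Measure.pi fun _ => ν).withDensity fun x => vdm Q x ^ 2

/-- The law `∏_{k ≥ 1} Prob_k` of the random array whose `k`-th row has `k` points; the row with
`k + 1` points has index `k : ℕ`. (Mathlib's `Measure.infinitePi` is the product measure when all
factors are probability measures.) -/
def arrayLaw (Q : X → EReal) (ν : Measure X) : Measure (∀ k : ℕ, Fin (k + 1) → X) :=
  Measure.infinitePi fun k : ℕ => vdmEnsemble Q ν (k + 1)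

end

/-- The empirical measure `(1 / k) ∑_j δ_{x_j}` of `k ≥ 1` points. -/
def empirical {X : Type*} [MeasurableSpace X] {k : ℕ} [NeZero k] (x : Fin k → X) :
    ProbabilityMeasure X :=
  ⟨(k : ℝ≥0∞)⁻¹ • ∑ j : Fin k, Measure.dirac (x j), ⟨by
    have hk : (k : ℝ≥0∞) ≠ 0 := Nat.cast_ne_zero.mpr (NeZero.ne k)
    simp [ENNReal.inv_mul_cancel hk (ENNReal.natCast_ne_top k)]⟩⟩

end

end WeightedLogPotential

/-! Normalize the kernel. On the compact set `K` the distances are at most some `R` and, by lower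
semicontinuity of `Q`, the weights are at most some finite `M`. Hence |x-y| w(x) w(y) = C
exp(-H(x,y)) with C = R M² and H symmetric, lower semicontinuous and [0,∞]-valued. Weighted energies
become H-energies minus log C, and the normalized Vandermonde becomes C times exp of minus the mean
of H over pairs, so everything reduces to H.

Averaging over independent points shows that the discrete minimum is at most the continuous one.
Conversely, weak limits of empirical measures of configurations with mean energy at most c have
energy at most c; truncating H removes the infinite diagonal (`kernelEnergy_le_of_tendsto`). With
weak compactness this gives the limit of the diameters, and it makes asymptotically minimal
configurations converge once the minimizer is unique.

For uniqueness, minimality tested at the midpoint of two minimizers bounds the sum of their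
logarithmic self-energies by twice the mutual one (`add_le_two_mul_of_minimizers`). The logarithm is
a positive superposition of Gaussians up to constants, and Gaussians have positive Fourier
transform, so this forces equality (`eq_of_logKernel_le`).

For the random array, the event that the mean energy exceeds some c > v, where v is the minimal
H-energy, has probability decaying fast enough for Borel–Cantelli, because the hypothesis on the
partition function bounds it from below on the scale C exp(-v) (`ae_eventually_pairMean_le`). -/

namespace WeightedLogPotential

noncomputable section

/-! ### Energies of lower semicontinuous kernels: discrete versus continuous minimization. -/

section Kernel

/-- The energy of a measure with respect to a kernel with values in `[0, ∞]`. -/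
def kernelEnergy {X : Type*} [MeasurableSpace X] (H : X × X → ℝ≥0∞) (μ : Measure X) : ℝ≥0∞ :=
  ∫⁻ p, H p ∂(μ.prod μ)

/-- The sum of a kernel over the pairs `i < j` of a configuration. -/
def pairSum {X : Type*} (H : X × X → ℝ≥0∞) {k : ℕ} (x : Fin k → X) : ℝ≥0∞ :=
  ∑ i : Fin k, ∑ j ∈ Finset.Ioi i, H (x i, x j)

/-- The mean of a kernel over the pairs `i < j` of a configuration. -/
def pairMean {X : Type*} (H : X × X → ℝ≥0∞) {k : ℕ} (x : Fin k → X) : ℝ≥0∞ :=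
  ENNReal.ofReal (2 / ((k : ℝ) * ((k : ℝ) - 1))) * pairSum H x

lemma sum_sum_eq_two_mul_pairSum_add {X : Type*} {H : X × X → ℝ≥0∞}
    (hs : ∀ x y, H (x, y) = H (y, x)) {k : ℕ} (x : Fin k → X) :
    ∑ i, ∑ j, H (x i, x j) = 2 * pairSum H x + ∑ i, H (x i, x i) := by
  have h1 : ∀ i : Fin k, ∑ j, H (x i, x j)
      = ∑ j ∈ Finset.Iio i, H (x i, x j) + ∑ j ∈ Finset.Ioi i, H (x i, x j) + H (x i, x i) := by
    intro i
    rw [← Finset.sum_filter_add_sum_filter_not Finset.univ (fun j => j < i),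
      ← Finset.sum_filter_add_sum_filter_not (Finset.univ.filter fun j => ¬ j < i)
        (fun j => i < j), ← add_assoc]
    congr 1
    · congr 1
      · exact Finset.sum_congr (by ext; simp) fun _ _ => rfl
      · refine Finset.sum_congr ?_ fun _ _ => rfl
        ext j
        simp only [Finset.mem_filter, Finset.mem_univ, true_and, Finset.mem_Ioi]
        exact ⟨fun h => h.2, fun h => ⟨h.le.not_gt, h⟩⟩
    · have : (Finset.univ.filter fun j => ¬ j < i).filter (fun j => ¬ i < j) = {i} := by
        ext j
        simp only [Finset.mem_filter, Finset.mem_univ, true_and, Finset.mem_singleton, not_lt]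
        exact ⟨fun h => le_antisymm h.2 h.1, fun h => by simp [h]⟩
      rw [this, Finset.sum_singleton]
  have h2 : ∑ i : Fin k, ∑ j ∈ Finset.Iio i, H (x i, x j) = pairSum H x := by
    rw [pairSum, Finset.sum_comm' (s' := fun j => Finset.Ioi j) (t' := Finset.univ) (by simp)]
    exact Finset.sum_congr rfl fun i _ => Finset.sum_congr rfl fun j _ => hs _ _
  simp_rw [h1, Finset.sum_add_distrib]
  rw [h2, pairSum, two_mul]

lemma pairSum_mono {X : Type*} {H H' : X × X → ℝ≥0∞} (h : ∀ p, H p ≤ H' p) {k : ℕ} (x : Fin k → X) :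
    pairSum H x ≤ pairSum H' x :=
  Finset.sum_le_sum fun _ _ => Finset.sum_le_sum fun _ _ => h _

lemma sum_card_Ioi (k : ℕ) :
    ((∑ i : Fin k, (Finset.Ioi i).card : ℕ) : ℝ) = (k : ℝ) * ((k : ℝ) - 1) / 2 := by
  rcases k with _ | k
  · simp
  have h := Finset.sum_range_id_mul_two (k + 1)
  have h2 : (∑ i : Fin (k + 1), (Finset.Ioi i).card) = ∑ i ∈ Finset.range (k + 1), i := by
    simp only [Fin.card_Ioi]
    rw [Fin.sum_univ_eq_sum_range (fun i => k + 1 - 1 - i),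
      Finset.sum_range_reflect (fun i => i)]
  rw [h2, eq_div_iff two_ne_zero]
  have h3 : ((∑ i ∈ Finset.range (k + 1), i : ℕ) : ℝ) * 2 = ((k + 1 : ℕ) : ℝ) * ((k : ℕ) : ℝ) := by
    exact_mod_cast h
  rw [h3]
  push_cast
  ring

lemma lintegral_pi_pair {X : Type*} [MeasurableSpace X] {H : X × X → ℝ≥0∞}
    (hH : Measurable H) (μ : ProbabilityMeasure X) {k : ℕ} {i j : Fin k} (hij : i ≠ j) :
    ∫⁻ x : Fin k → X, H (x i, x j) ∂(Measure.pi fun _ => (μ : Measure X))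
      = kernelEnergy H (μ : Measure X) := by
  have h1 := (ProbabilityTheory.iIndepFun_pi (μ := fun _ : Fin k => (μ : Measure X))
    (X := fun _ => id) fun _ => aemeasurable_id).indepFun hij
  rw [ProbabilityTheory.indepFun_iff_map_prod_eq_prod_map_map (f := fun ω : Fin k → X => id (ω i))
    (g := fun ω : Fin k → X => id (ω j)) (measurable_pi_apply i).aemeasurable
    (measurable_pi_apply j).aemeasurable] at h1
  have hi : ∀ i : Fin k, Measure.map (fun ω : Fin k → X => id (ω i))
      (Measure.pi fun _ => (μ : Measure X)) = μ := fun i =>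
    (measurePreserving_eval (fun _ : Fin k => (μ : Measure X)) i).map_eq
  rw [hi, hi] at h1
  rw [kernelEnergy, ← h1, lintegral_map hH (by fun_prop)]
  rfl

/-- An infimum is at most a mean: for k independent points of law μ, each of the k(k-1)/2 pairs has
expected interaction equal to the energy of μ. -/
lemma iInf_pairMean_le_kernelEnergy {X : Type*} [MeasurableSpace X] {H : X × X → ℝ≥0∞}
    (hH : Measurable H) (μ : ProbabilityMeasure X) {k : ℕ}
    (hk : 2 ≤ k) : ⨅ x : Fin k → X, pairMean H x ≤ kernelEnergy H (μ : Measure X) := by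
  refine (iInf_le_lintegral (μ := Measure.pi fun _ : Fin k => (μ : Measure X)) _).trans ?_
  have hm : ∀ i j : Fin k, Measurable fun x : Fin k → X => H (x i, x j) := fun i j =>
    hH.comp (by fun_prop)
  have hsum : ∫⁻ x : Fin k → X, pairSum H x ∂(Measure.pi fun _ => (μ : Measure X))
      = (∑ i : Fin k, ((Finset.Ioi i).card : ℝ≥0∞)) * kernelEnergy H (μ : Measure X) := by
    simp only [pairSum]
    rw [lintegral_finsetSum _ fun i _ => Finset.measurable_sum _ fun j _ => hm i j, Finset.sum_mul]
    refine Finset.sum_congr rfl fun i _ => ?_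
    rw [lintegral_finsetSum _ fun j _ => hm i j, Finset.sum_congr rfl fun j hj =>
      lintegral_pi_pair hH μ (Finset.mem_Ioi.1 hj).ne, Finset.sum_const, nsmul_eq_mul]
  simp only [pairMean]
  rw [lintegral_const_mul _ (by unfold pairSum; fun_prop), hsum, ← mul_assoc]
  refine le_of_eq ?_
  have hkr : (2 : ℝ) ≤ k := by exact_mod_cast hk
  have hc : (∑ i : Fin k, ((Finset.Ioi i).card : ℝ≥0∞))
      = ENNReal.ofReal ((k : ℝ) * ((k : ℝ) - 1) / 2) := by
    rw [← sum_card_Ioi, ENNReal.ofReal_natCast, Nat.cast_sum]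
  have hp : 0 < (k : ℝ) * ((k : ℝ) - 1) := by nlinarith
  rw [hc, ← ENNReal.ofReal_mul (by positivity), div_mul_div_cancel₀ hp.ne', div_self two_ne_zero,
    ENNReal.ofReal_one, one_mul]

lemma lintegral_eq_iSup_lintegral_min {X : Type*} [MeasurableSpace X] {f : X → ℝ≥0∞}
    (hf : Measurable f) (μ : Measure X) :
    ∫⁻ x, f x ∂μ = ⨆ m : ℕ, ∫⁻ x, min (f x) m ∂μ := by
  rw [← lintegral_iSup (fun m => hf.min measurable_const)
    fun a b hab x => min_le_min le_rfl (by exact_mod_cast hab)]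
  refine lintegral_congr fun x => le_antisymm ?_ (iSup_le fun m => min_le_left _ _)
  rcases eq_or_ne (f x) ⊤ with h | h
  · simp [h, ENNReal.iSup_natCast]
  · obtain ⟨m, hm⟩ := ENNReal.exists_nat_gt h
    exact le_iSup_of_le m (by simp [hm.le])

/-- Layer-cake formula, portmanteau on the open superlevel sets, and Fatou along 𝓝 μ, for which
first countability is needed. Truncation at m makes the layer-cake formula for real functions
applicable; a supremum of lower semicontinuous functions is again such. -/
lemma lowerSemicontinuous_lintegral {X : Type*} [MeasurableSpace X] [TopologicalSpace X]
    [OpensMeasurableSpace X] [HasOuterApproxClosed X]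
    [FirstCountableTopology (ProbabilityMeasure X)] {f : X → ℝ≥0∞} (hf : LowerSemicontinuous f) :
    LowerSemicontinuous fun μ : ProbabilityMeasure X => ∫⁻ x, f x ∂(μ : Measure X) := by
  have key : ∀ m : ℕ, LowerSemicontinuous fun μ : ProbabilityMeasure X =>
      ∫⁻ x, min (f x) m ∂(μ : Measure X) := by
    intro m
    rw [lowerSemicontinuous_iff_le_liminf]
    intro μ
    have hm : Measurable fun x => (min (f x) (m : ℝ≥0∞)).toReal :=
      (hf.measurable.min measurable_const).ennreal_toReal
    have hl : ∀ ρ : Measure X, ∫⁻ x, min (f x) m ∂ρ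
        = ∫⁻ t : ℝ in Set.Ioi 0, ρ {x | t < (min (f x) (m : ℝ≥0∞)).toReal} := by
      intro ρ
      rw [← lintegral_eq_lintegral_meas_lt ρ (Eventually.of_forall fun _ => ENNReal.toReal_nonneg)
        hm.aemeasurable]
      refine lintegral_congr fun x => ?_
      rw [ENNReal.ofReal_toReal (ne_top_of_le_ne_top (ENNReal.natCast_ne_top m) (min_le_right _ _))]
    have hopen : ∀ t : ℝ, 0 < t → IsOpen {x | t < (min (f x) (m : ℝ≥0∞)).toReal} := by
      intro t ht
      have : {x | t < (min (f x) (m : ℝ≥0∞)).toReal}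
          = (fun x => min (f x) (m : ℝ≥0∞)) ⁻¹' Set.Ioi (ENNReal.ofReal t) := by
        ext x
        simp only [Set.mem_ofPred_eq, Set.mem_preimage, Set.mem_Ioi]
        rw [ENNReal.ofReal_lt_iff_lt_toReal ht.le
          (ne_top_of_le_ne_top (ENNReal.natCast_ne_top m) (min_le_right _ _))]
      rw [this]
      exact (hf.inf continuous_const.lowerSemicontinuous).isOpen_preimage _
    simp_rw [hl]
    refine le_trans (setLIntegral_mono' measurableSet_Ioi fun t ht => ?_)
      (lintegral_liminf_le (u := 𝓝 μ) fun ρ : ProbabilityMeasure X => Antitone.measurable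
        fun s t hst => measure_mono fun ω hω => lt_of_le_of_lt hst hω)
    have h := ProbabilityMeasure.le_liminf_measure_open_of_tendsto
      (μs := fun ρ : ProbabilityMeasure X => ρ) (L := 𝓝 μ) tendsto_id (hopen t ht)
    exact h
  have hsup : (fun μ : ProbabilityMeasure X => ∫⁻ x, f x ∂(μ : Measure X))
      = fun μ : ProbabilityMeasure X => ⨆ m : ℕ, ∫⁻ x, min (f x) m ∂(μ : Measure X) := by
    ext μ
    exact lintegral_eq_iSup_lintegral_min hf.measurable _
  rw [hsup]
  exact lowerSemicontinuous_iSup key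

variable {X : Type*} [MetricSpace X] [CompactSpace X] [MeasurableSpace X] [BorelSpace X]
  {H : X × X → ℝ≥0∞}

lemma lowerSemicontinuous_kernelEnergy (hH : LowerSemicontinuous H) :
    LowerSemicontinuous fun μ : ProbabilityMeasure X => kernelEnergy H (μ : Measure X) :=
  (lowerSemicontinuous_lintegral hH).comp
    (ProbabilityMeasure.continuous_prod.comp (continuous_id.prodMk continuous_id))

lemma kernelEnergy_empirical (hH : Measurable H) {k : ℕ} [NeZero k] (x : Fin k → X) :
    kernelEnergy H (empirical x : Measure X)
      = (k : ℝ≥0∞)⁻¹ * ((k : ℝ≥0∞)⁻¹ * ∑ i, ∑ j, H (x i, x j)) := by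
  rw [kernelEnergy, lintegral_prod _ hH.aemeasurable]
  simp only [empirical, ProbabilityMeasure.coe_mk, lintegral_smul_measure,
    lintegral_finsetSum_measure, smul_eq_mul, lintegral_dirac]
  simp_rw [Finset.mul_sum]

/-- The energy of an empirical measure with respect to a truncated kernel. -/
lemma kernelEnergy_min_empirical_le (hH : Measurable H) (hs : ∀ x y, H (x, y) = H (y, x)) (m : ℕ)
    {k : ℕ} (hk : 1 ≤ k) (x : Fin (k + 1) → X) :
    kernelEnergy (fun p => min (H p) m) (empirical x : Measure X)
      ≤ pairMean H x + m * ((k + 1 : ℕ) : ℝ≥0∞)⁻¹ := by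
  have hk0 : ((k + 1 : ℕ) : ℝ≥0∞) ≠ 0 := by simp
  have hkt : ((k + 1 : ℕ) : ℝ≥0∞) ≠ ⊤ := ENNReal.natCast_ne_top _
  rw [kernelEnergy_empirical (hH.min measurable_const),
    sum_sum_eq_two_mul_pairSum_add (H := fun p => min (H p) (m : ℝ≥0∞)) (fun x y => by simp [hs x y]),
    mul_add, mul_add]
  refine add_le_add ?_ ?_
  -- The empirical energy weights each unordered pair by 2/(k+1)², which is below the weight
  -- 2/((k+1)k) in the pair mean.
  · have hc : ((k + 1 : ℕ) : ℝ≥0∞)⁻¹ * (((k + 1 : ℕ) : ℝ≥0∞)⁻¹ * 2)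
        ≤ ENNReal.ofReal (2 / (((k + 1 : ℕ) : ℝ) * (((k + 1 : ℕ) : ℝ) - 1))) := by
      have hkpos : (0 : ℝ) < k := by exact_mod_cast hk
      rw [← ENNReal.ofReal_natCast, ← ENNReal.ofReal_inv_of_pos (by positivity),
        show (2 : ℝ≥0∞) = ENNReal.ofReal 2 by simp, ← ENNReal.ofReal_mul (by positivity),
        ← ENNReal.ofReal_mul (by positivity)]
      refine ENNReal.ofReal_le_ofReal ?_
      push_cast
      rw [add_sub_cancel_right, ← mul_assoc, ← mul_inv, ← div_eq_inv_mul]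
      gcongr
      linarith
    calc _ = ((k + 1 : ℕ) : ℝ≥0∞)⁻¹ * (((k + 1 : ℕ) : ℝ≥0∞)⁻¹ * 2)
          * pairSum (fun p => min (H p) (m : ℝ≥0∞)) x := by ring
      _ ≤ _ := mul_le_mul' hc (pairSum_mono (fun p => min_le_left _ _) x)
  · calc _ ≤ ((k + 1 : ℕ) : ℝ≥0∞)⁻¹ * (((k + 1 : ℕ) : ℝ≥0∞)⁻¹ * ∑ _i : Fin (k + 1), (m : ℝ≥0∞)) := by
          gcongr
          exact min_le_right _ _
      _ = (((k + 1 : ℕ) : ℝ≥0∞)⁻¹ * ((k + 1 : ℕ) : ℝ≥0∞)) * (m * ((k + 1 : ℕ) : ℝ≥0∞)⁻¹) := by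
          rw [Finset.sum_const, Finset.card_univ, Fintype.card_fin, nsmul_eq_mul]; ring
      _ = _ := by rw [ENNReal.inv_mul_cancel hk0 hkt, one_mul]

/-- The energy of an empirical measure sees the diagonal, where H may be infinite. For H truncated
at m the diagonal costs at most m/(k+1), which vanishes; semicontinuity passes the bound to σ, and
then m → ∞ by monotone convergence. -/
lemma kernelEnergy_le_of_tendsto (hH : LowerSemicontinuous H) (hs : ∀ x y, H (x, y) = H (y, x))
    {l : Filter ℕ} [NeBot l] (hl : l ≤ atTop) {x : ∀ k : ℕ, Fin (k + 1) → X}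
    {σ : ProbabilityMeasure X} (hσ : Tendsto (fun k => empirical (x k)) l (𝓝 σ)) {c : ℝ≥0∞}
    (hc : ∀ᶠ k in l, pairMean H (x k) ≤ c) : kernelEnergy H (σ : Measure X) ≤ c := by
  have key : ∀ m : ℕ, kernelEnergy (fun p => min (H p) (m : ℝ≥0∞)) (σ : Measure X) ≤ c := by
    intro m
    by_contra! hlt
    have hlsc : LowerSemicontinuous fun p => min (H p) (m : ℝ≥0∞) :=
      hH.inf continuous_const.lowerSemicontinuous
    obtain ⟨c', hcc', hc'⟩ := exists_between hlt
    have h1 : ∀ᶠ k in l, c' < kernelEnergy (fun p => min (H p) (m : ℝ≥0∞))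
        (empirical (x k) : Measure X) :=
      hσ.eventually (lowerSemicontinuous_kernelEnergy hlsc σ c' hc')
    have h2 : Tendsto (fun k : ℕ => c + m * ((k + 1 : ℕ) : ℝ≥0∞)⁻¹) atTop (𝓝 c) := by
      have h3 : Tendsto (fun k : ℕ => ((k + 1 : ℕ) : ℝ≥0∞)⁻¹) atTop (𝓝 0) :=
        (tendsto_add_atTop_iff_nat 1).2 ENNReal.tendsto_inv_nat_nhds_zero
      simpa using (ENNReal.Tendsto.const_mul h3 (Or.inr (ENNReal.natCast_ne_top m))).const_add c
    have h4 : ∀ᶠ k in l, c + m * ((k + 1 : ℕ) : ℝ≥0∞)⁻¹ < c' :=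
      hl (h2.eventually (gt_mem_nhds hcc'))
    obtain ⟨k, hk1, hk2, hk3, hk4⟩ :=
      (h1.and (h4.and (hc.and (hl (eventually_ge_atTop 1))))).exists
    have := kernelEnergy_min_empirical_le hH.measurable hs m hk4 (x k)
    exact absurd (hk1.trans_le (this.trans (by gcongr))) hk2.not_gt
  rw [kernelEnergy, lintegral_eq_iSup_lintegral_min hH.measurable]
  exact iSup_le key

/-- The discrete minimal energies converge to the continuous one. -/
lemma tendsto_iInf_pairMean (hH : LowerSemicontinuous H) (hs : ∀ x y, H (x, y) = H (y, x)) :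
    Tendsto (fun k : ℕ => ⨅ x : Fin (k + 1) → X, pairMean H x) atTop
      (𝓝 (⨅ μ : ProbabilityMeasure X, kernelEnergy H (μ : Measure X))) := by
  rw [tendsto_order]
  constructor
  · intro c hc
    by_contra hcon
    obtain ⟨c', hcc', hc'⟩ := exists_between hc
    -- Near-minimal configurations matter only for the rows whose infimum is at most c; elsewhere
    -- any point serves. For empty X every infimum is ⊤, which contradicts `hcon`.
    have hex : ∀ k : ℕ, ∃ x : Fin (k + 1) → X,
        (⨅ x : Fin (k + 1) → X, pairMean H x) ≤ c → pairMean H x ≤ c' := by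
      intro k
      by_cases h : (⨅ x : Fin (k + 1) → X, pairMean H x) ≤ c
      · obtain ⟨x, hx⟩ := iInf_lt_iff.1 (h.trans_lt hcc')
        exact ⟨x, fun _ => hx.le⟩
      · have : Nonempty X := by
          by_contra hne
          rw [not_nonempty_iff] at hne
          have : IsEmpty (ProbabilityMeasure X) := ⟨fun μ => by
            have h1 : (μ : Measure X) Set.univ = 1 := measure_univ
            rw [Set.univ_eq_empty_iff.2 hne, measure_empty] at h1
            exact zero_ne_one h1⟩
          exact hcon (Eventually.of_forall fun k => by
            have : IsEmpty (Fin (k + 1) → X) := ⟨fun f => hne.false (f 0)⟩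
            rw [iInf_of_empty]
            exact lt_of_lt_of_le hc le_top)
        exact ⟨fun _ => Classical.arbitrary X, fun h' => absurd h' h⟩
    choose x hx using hex
    have hfreq : ∃ᶠ k : ℕ in atTop, (⨅ x : Fin (k + 1) → X, pairMean H x) ≤ c := by
      simpa only [Filter.Frequently, not_le] using hcon
    have : NeBot (atTop ⊓ 𝓟 {k : ℕ | (⨅ x : Fin (k + 1) → X, pairMean H x) ≤ c}) :=
      frequently_mem_iff_neBot.1 hfreq
    -- An ultrafilter on the bad rows plays the role of a convergent subsequence; its limit would
    -- have energy at most c', below the infimum.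
    let u := Ultrafilter.of (atTop ⊓ 𝓟 {k : ℕ | (⨅ x : Fin (k + 1) → X, pairMean H x) ≤ c})
    have hu : (u : Filter ℕ) ≤ _ := Ultrafilter.of_le _
    obtain ⟨σ, -, hσ⟩ := isCompact_univ.ultrafilter_le_nhds (u.map fun k => empirical (x k))
      (by simp)
    have hle := kernelEnergy_le_of_tendsto hH hs (hu.trans inf_le_left) (σ := σ) (x := x) hσ
      (c := c') (by
        filter_upwards [hu (mem_inf_of_right (mem_principal_self _))] with k hk using hx k hk)
    exact absurd ((iInf_le _ σ).trans hle) hc'.not_ge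
  · intro c hc
    obtain ⟨μ, hμ⟩ := iInf_lt_iff.1 hc
    filter_upwards [eventually_ge_atTop 1] with k hk
    exact (iInf_pairMean_le_kernelEnergy hH.measurable μ (by omega)).trans_lt hμ

/-- Configurations of asymptotically minimal energy converge to the minimizer of the energy, if it
is unique. -/
lemma tendsto_empirical_of_unique (hH : LowerSemicontinuous H) (hs : ∀ x y, H (x, y) = H (y, x))
    {μ : ProbabilityMeasure X}
    (hμ : ∀ μ' : ProbabilityMeasure X, kernelEnergy H (μ' : Measure X)
      = (⨅ ρ : ProbabilityMeasure X, kernelEnergy H (ρ : Measure X)) → μ' = μ)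
    {x : ∀ k : ℕ, Fin (k + 1) → X}
    (hx : ∀ c, (⨅ ρ : ProbabilityMeasure X, kernelEnergy H (ρ : Measure X)) < c →
      ∀ᶠ k in atTop, pairMean H (x k) ≤ c) :
    Tendsto (fun k => empirical (x k)) atTop (𝓝 μ) := by
  -- By compactness every ultrafilter has a limit, and each such limit is a minimizer, hence equal
  -- to μ.
  rw [tendsto_iff_ultrafilter]
  intro u hu
  obtain ⟨σ, -, hσ⟩ := isCompact_univ.ultrafilter_le_nhds (u.map fun k => empirical (x k))
    (by simp)
  have hle : kernelEnergy H (σ : Measure X)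
      ≤ ⨅ ρ : ProbabilityMeasure X, kernelEnergy H (ρ : Measure X) :=
    le_of_forall_gt_imp_ge_of_dense fun c hc =>
      kernelEnergy_le_of_tendsto hH hs hu (σ := σ) (x := x) hσ (hu (hx c hc))
  rw [← hμ σ (le_antisymm hle (iInf_le _ σ))]
  exact hσ

lemma exists_kernelEnergy_eq_iInf [Nonempty (ProbabilityMeasure X)] (hH : LowerSemicontinuous H) :
    ∃ μ : ProbabilityMeasure X, kernelEnergy H (μ : Measure X)
      = ⨅ ρ : ProbabilityMeasure X, kernelEnergy H (ρ : Measure X) := by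
  obtain ⟨μ, -, hμ⟩ := ((lowerSemicontinuous_kernelEnergy hH).lowerSemicontinuousOn
    Set.univ).exists_isMinOn Set.univ_nonempty isCompact_univ
  exact ⟨μ, le_antisymm (le_iInf fun ρ => hμ (Set.mem_univ ρ)) (iInf_le _ μ)⟩

end Kernel

/-! ### Strict positive definiteness of Gaussian kernels by Fourier transform. -/

section Gaussian

variable {V : Type*} [NormedAddCommGroup V] [InnerProductSpace ℝ V] [FiniteDimensional ℝ V]
  [MeasurableSpace V]

lemma charFun_mul_conj_charFun (μ ν : Measure V) [IsProbabilityMeasure μ] [IsProbabilityMeasure ν]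
    (v : V) :
    charFun μ v * (starRingEnd ℂ) (charFun ν v)
      = ∫ p : V × V, Complex.exp (Complex.I * (inner ℝ (p.1 - p.2) v : ℝ)) ∂(μ.prod ν) := by
  rw [charFun_apply, charFun_apply, ← integral_conj, ← integral_prod_mul]
  refine integral_congr_ae (Eventually.of_forall fun p => ?_)
  simp only [← Complex.exp_conj, map_mul, Complex.conj_ofReal, Complex.conj_I, ← Complex.exp_add,
    inner_sub_left, Complex.ofReal_sub]
  congr 1
  ring

variable [BorelSpace V]

/-- The Gaussian kernel is the Fourier transform of a Gaussian density. -/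
lemma exists_gaussian_eq_charFun {t : ℝ} (ht : 0 < t) :
    ∃ A b : ℝ, 0 < A ∧ 0 < b ∧ ∀ (μ ν : Measure V) [IsProbabilityMeasure μ]
      [IsProbabilityMeasure ν],
      ((A * ∫ p : V × V, Real.exp (-t * ‖p.1 - p.2‖ ^ 2) ∂(μ.prod ν) : ℝ) : ℂ)
        = ∫ v : V, (Real.exp (-b * ‖v‖ ^ 2) : ℂ) *
          (charFun μ v * (starRingEnd ℂ) (charFun ν v)) := by
  -- The transform of exp(-b|v|²) at w is (π/b)^(d/2) exp(-|w|²/(4b)), so b = 1/(4t) gives the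
  -- exponent t.
  have hb : 0 < 1 / (4 * t) := by positivity
  have hbc : 0 < ((1 / (4 * t) : ℝ) : ℂ).re := by simpa using ht
  refine ⟨(Real.pi / (1 / (4 * t))) ^ (Module.finrank ℝ V / 2 : ℝ), 1 / (4 * t), by positivity, hb,
    fun μ ν _ _ => ?_⟩
  have hg : ∀ w : V, ∫ v : V, (Real.exp (-(1 / (4 * t)) * ‖v‖ ^ 2) : ℂ) *
      Complex.exp (Complex.I * (inner ℝ w v : ℝ))
      = ((Real.pi / (1 / (4 * t))) ^ (Module.finrank ℝ V / 2 : ℝ) : ℝ) *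
        (Real.exp (-t * ‖w‖ ^ 2) : ℂ) := by
    intro w
    have := GaussianFourier.integral_cexp_neg_mul_sq_norm_add hbc Complex.I w
    simp only [Complex.exp_add] at this
    convert this using 1
    · refine integral_congr_ae (Eventually.of_forall fun v => ?_)
      simp
    · congr 1
      · rw [Complex.ofReal_cpow (by positivity)]
        push_cast
        rfl
      · rw [Complex.I_sq]
        push_cast
        congr 1
        have : (t : ℂ) ≠ 0 := by exact_mod_cast ht.ne'
        field_simp
  simp_rw [charFun_mul_conj_charFun, ← integral_const_mul]
  rw [integral_integral_swap]
  · simp_rw [hg]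
    rw [← integral_complex_ofReal]
    exact integral_congr_ae (Eventually.of_forall fun p => Complex.ofReal_mul _ _)
  · have h0 := GaussianFourier.integrable_cexp_neg_mul_sq_norm_add (V := V) hbc 0 0
    have h1 := h0.mul_prod
      (integrable_const (1 : ℂ) : Integrable (fun _ : V × V => (1 : ℂ)) (μ.prod ν))
    refine h1.mono (Continuous.aestronglyMeasurable (by fun_prop))
      (Eventually.of_forall fun z => ?_)
    simp only [Function.uncurry]
    rw [norm_mul, mul_comm Complex.I, Complex.norm_exp_ofReal_mul_I]
    simp

/-- The Gaussian energy of the signed measure μ - ν is, up to A, a weighted L² norm of the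
difference of characteristic functions: expand |a - b|² and apply the Fourier formula to each of the
four products. -/
lemma exists_gaussian_energy_eq {t : ℝ} (ht : 0 < t) (μ ν : Measure V) [IsProbabilityMeasure μ]
    [IsProbabilityMeasure ν] :
    ∃ A b : ℝ, 0 < A ∧ 0 < b ∧
      Integrable (fun v : V => Real.exp (-b * ‖v‖ ^ 2) * ‖charFun μ v - charFun ν v‖ ^ 2) ∧
      A * (∫ p : V × V, Real.exp (-t * ‖p.1 - p.2‖ ^ 2) ∂(μ.prod μ) +
        ∫ p : V × V, Real.exp (-t * ‖p.1 - p.2‖ ^ 2) ∂(ν.prod ν) -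
        2 * ∫ p : V × V, Real.exp (-t * ‖p.1 - p.2‖ ^ 2) ∂(μ.prod ν))
        = ∫ v : V, Real.exp (-b * ‖v‖ ^ 2) * ‖charFun μ v - charFun ν v‖ ^ 2 := by
  obtain ⟨A, b, hA, hb, h⟩ := exists_gaussian_eq_charFun (V := V) ht
  have hbc : 0 < ((b : ℝ) : ℂ).re := by simpa using hb
  have hint : ∀ (μ ν : Measure V) [IsProbabilityMeasure μ] [IsProbabilityMeasure ν],
      Integrable fun v : V => (Real.exp (-b * ‖v‖ ^ 2) : ℂ) *
          (charFun μ v * (starRingEnd ℂ) (charFun ν v)) := by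
    intro μ ν _ _
    have h0 := GaussianFourier.integrable_cexp_neg_mul_sq_norm_add (V := V) hbc 0 0
    refine h0.mono ?_ (Eventually.of_forall fun v => ?_)
    · exact Continuous.aestronglyMeasurable (by fun_prop)
    · rw [norm_mul, norm_mul, RCLike.norm_conj]
      have h1 := norm_charFun_le_one (μ := μ) v
      have h2 := norm_charFun_le_one (μ := ν) v
      calc _ ≤ ‖(Real.exp (-b * ‖v‖ ^ 2) : ℂ)‖ * (1 * 1) := by gcongr
        _ = _ := by simp
  have hpt : ∀ v : V, ((Real.exp (-b * ‖v‖ ^ 2) * ‖charFun μ v - charFun ν v‖ ^ 2 : ℝ) : ℂ)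
      = (Real.exp (-b * ‖v‖ ^ 2) : ℂ) * (charFun μ v * (starRingEnd ℂ) (charFun μ v))
        + (Real.exp (-b * ‖v‖ ^ 2) : ℂ) * (charFun ν v * (starRingEnd ℂ) (charFun ν v))
        - ((Real.exp (-b * ‖v‖ ^ 2) : ℂ) * (charFun μ v * (starRingEnd ℂ) (charFun ν v))
        + (Real.exp (-b * ‖v‖ ^ 2) : ℂ) * (charFun ν v * (starRingEnd ℂ) (charFun μ v))) := by
    intro v
    rw [Complex.ofReal_mul, Complex.ofReal_pow, ← Complex.mul_conj']
    simp only [map_sub]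
    ring
  have hsymm : ∫ p : V × V, Real.exp (-t * ‖p.1 - p.2‖ ^ 2) ∂(ν.prod μ)
      = ∫ p : V × V, Real.exp (-t * ‖p.1 - p.2‖ ^ 2) ∂(μ.prod ν) := by
    rw [← integral_prod_swap]
    simp [norm_sub_rev]
  refine ⟨A, b, hA, hb, ?_, ?_⟩
  · have := (((hint μ μ).add (hint ν ν)).sub ((hint μ ν).add (hint ν μ))).re
    refine this.congr (Eventually.of_forall fun v => ?_)
    have h2 := congrArg Complex.re (hpt v)
    rw [Complex.ofReal_re] at h2
    exact h2.symm
  · apply Complex.ofReal_injective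
    rw [← integral_complex_ofReal]
    simp_rw [hpt]
    rw [integral_sub, integral_add (hint μ μ) (hint ν ν), integral_add (hint μ ν) (hint ν μ),
      ← h μ μ, ← h ν ν, ← h μ ν, ← h ν μ, hsymm]
    · push_cast
      ring
    · exact (hint μ μ).add (hint ν ν)
    · exact (hint μ ν).add (hint ν μ)

lemma two_mul_gaussian_le {t : ℝ} (ht : 0 < t) (μ ν : Measure V) [IsProbabilityMeasure μ]
    [IsProbabilityMeasure ν] :
    2 * ∫ p : V × V, Real.exp (-t * ‖p.1 - p.2‖ ^ 2) ∂(μ.prod ν)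
      ≤ ∫ p : V × V, Real.exp (-t * ‖p.1 - p.2‖ ^ 2) ∂(μ.prod μ) +
        ∫ p : V × V, Real.exp (-t * ‖p.1 - p.2‖ ^ 2) ∂(ν.prod ν) := by
  obtain ⟨A, b, hA, hb, -, h⟩ := exists_gaussian_energy_eq ht μ ν
  have h0 : 0 ≤ ∫ v : V, Real.exp (-b * ‖v‖ ^ 2) * ‖charFun μ v - charFun ν v‖ ^ 2 :=
    integral_nonneg fun v => by positivity
  rw [← h] at h0
  linarith [nonneg_of_mul_nonneg_right h0 hA]

/-- A vanishing weighted L² norm makes the characteristic functions agree almost everywhere, hence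
everywhere by continuity, and they determine the measure. -/
lemma eq_of_gaussian_le {t : ℝ} (ht : 0 < t) (μ ν : Measure V) [IsProbabilityMeasure μ]
    [IsProbabilityMeasure ν]
    (hle : ∫ p : V × V, Real.exp (-t * ‖p.1 - p.2‖ ^ 2) ∂(μ.prod μ) +
        ∫ p : V × V, Real.exp (-t * ‖p.1 - p.2‖ ^ 2) ∂(ν.prod ν)
      ≤ 2 * ∫ p : V × V, Real.exp (-t * ‖p.1 - p.2‖ ^ 2) ∂(μ.prod ν)) : μ = ν := by
  obtain ⟨A, b, hA, hb, hi, h⟩ := exists_gaussian_energy_eq ht μ ν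
  have h0 : ∫ v : V, Real.exp (-b * ‖v‖ ^ 2) * ‖charFun μ v - charFun ν v‖ ^ 2 = 0 := by
    refine le_antisymm ?_ (integral_nonneg fun v => by positivity)
    rw [← h]
    exact mul_nonpos_of_nonneg_of_nonpos hA.le (by linarith)
  rw [integral_eq_zero_iff_of_nonneg (fun v => by positivity) hi] at h0
  refine Measure.ext_of_charFun ?_
  rw [← Continuous.ae_eq_iff_eq volume (by fun_prop) (by fun_prop)]
  filter_upwards [h0] with v hv
  have hv' : Real.exp (-b * ‖v‖ ^ 2) * ‖charFun μ v - charFun ν v‖ ^ 2 = 0 := hv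
  rcases mul_eq_zero.1 hv' with h1 | h1
  · exact absurd h1 (Real.exp_pos _).ne'
  · exact sub_eq_zero.1 (norm_eq_zero.1 (pow_eq_zero_iff two_ne_zero |>.1 h1))

end Gaussian

/-! ### Frullani's integral for the logarithm. -/

section Frullani

/-- The integrand is the integral of exp(-ts) over s in (a,b]; exchange by Tonelli. Allowing a = 0,
where the value may be infinite, covers the diagonal of the logarithmic kernel. -/
lemma lintegral_exp_sub_exp_div {a b : ℝ} (ha : 0 ≤ a) (hab : a ≤ b) :
    ∫⁻ t in Set.Ioi (0 : ℝ), ENNReal.ofReal ((Real.exp (-t * a) - Real.exp (-t * b)) / t)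
      = ∫⁻ s in Set.Ioc a b, ENNReal.ofReal s⁻¹ := by
  have h1 : ∀ t ∈ Set.Ioi (0 : ℝ),
      ENNReal.ofReal ((Real.exp (-t * a) - Real.exp (-t * b)) / t)
        = ∫⁻ s in Set.Ioc a b, ENNReal.ofReal (Real.exp (-t * s)) := by
    intro t ht
    have ht' : t ≠ 0 := (Set.mem_Ioi.1 ht).ne'
    have h2 : ∫ s in a..b, Real.exp (-t * s) = (Real.exp (-t * a) - Real.exp (-t * b)) / t := by
      rw [intervalIntegral.integral_comp_mul_left (fun s => Real.exp s) (neg_ne_zero.2 ht'),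
        integral_exp, smul_eq_mul]
      field_simp
      ring
    rw [← h2, intervalIntegral.integral_of_le hab, ofReal_integral_eq_lintegral_ofReal]
    · exact (Continuous.integrableOn_Icc (by fun_prop)).mono_set Set.Ioc_subset_Icc_self
    · exact Eventually.of_forall fun s => (Real.exp_pos _).le
  rw [setLIntegral_congr_fun measurableSet_Ioi h1, lintegral_lintegral_swap (by fun_prop)]
  refine setLIntegral_congr_fun measurableSet_Ioc fun s hs => ?_
  have hs0 : 0 < s := ha.trans_lt hs.1
  have h3 := integral_exp_mul_Ioi (a := -s) (by linarith) 0
  have h4 := integrableOn_exp_mul_Ioi (a := -s) (by linarith) 0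
  have h5 : ∀ t : ℝ, -t * s = -s * t := fun t => by ring
  simp only [h5]
  rw [← ofReal_integral_eq_lintegral_ofReal h4 (Eventually.of_forall fun s => (Real.exp_pos _).le),
    h3]
  congr 1
  simp

lemma lintegral_inv_Ioc {a b : ℝ} (ha : 0 < a) (hab : a ≤ b) :
    ∫⁻ s in Set.Ioc a b, ENNReal.ofReal s⁻¹ = ENNReal.ofReal (Real.log (b / a)) := by
  rw [← integral_inv_of_pos ha (ha.trans_le hab), intervalIntegral.integral_of_le hab,
    ofReal_integral_eq_lintegral_ofReal]
  · refine (ContinuousOn.integrableOn_Icc ?_).mono_set Set.Ioc_subset_Icc_self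
    exact continuousOn_inv₀.mono fun s hs => (ha.trans_le hs.1).ne'
  · filter_upwards [ae_restrict_mem measurableSet_Ioc] with s hs
    exact inv_nonneg.2 (ha.trans hs.1).le

lemma lintegral_inv_Ioc_zero {b : ℝ} (hb : 0 < b) :
    ∫⁻ s in Set.Ioc 0 b, ENNReal.ofReal s⁻¹ = ⊤ := by
  refine ENNReal.eq_top_of_forall_nnreal_le fun r => ?_
  -- The interval from b exp(-r) to b alone contributes exactly r.
  have ha : 0 < b * Real.exp (-r) := by positivity
  have hab : b * Real.exp (-r) ≤ b := by
    have : Real.exp (-r) ≤ 1 := Real.exp_le_one_iff.2 (by simp)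
    nlinarith
  calc (r : ℝ≥0∞) = ENNReal.ofReal (Real.log (b / (b * Real.exp (-r)))) := by
        rw [div_mul_cancel_left₀ hb.ne', ← Real.exp_neg, neg_neg, Real.log_exp]
        simp
    _ = ∫⁻ s in Set.Ioc (b * Real.exp (-r)) b, ENNReal.ofReal s⁻¹ :=
        (lintegral_inv_Ioc ha hab).symm
    _ ≤ _ := lintegral_mono_set (Set.Ioc_subset_Ioc_left ha.le)

end Frullani

/-! ### Conversion between extended reals and [0,∞]. -/

/-- The positive part of `-log`, as a function with values in `[0, ∞]`. -/
def negLog (a : ℝ≥0∞) : ℝ≥0∞ := (-ENNReal.log a).toENNReal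

/-- The exponential `t ↦ exp (-t)` from `[0, ∞]` to `[0, 1]`. -/
def expNeg (t : ℝ≥0∞) : ℝ≥0∞ := EReal.exp (-(t : EReal))

section

lemma continuous_negLog : Continuous negLog :=
  EReal.continuous_toENNReal.comp (continuous_neg.comp ENNReal.continuous_log)

lemma antitone_negLog : Antitone negLog := fun _ _ h =>
  EReal.toENNReal_le_toENNReal (EReal.neg_le_neg_iff.2 (ENNReal.log_monotone h))

lemma coe_negLog {a : ℝ≥0∞} (ha : a ≤ 1) : (negLog a : EReal) = -ENNReal.log a :=
  EReal.coe_toENNReal (by simpa [EReal.le_neg] using ha)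

lemma negLog_zero : negLog 0 = ⊤ := by simp [negLog]

lemma negLog_ne_top {a : ℝ≥0∞} (ha : a ≠ 0) : negLog a ≠ ⊤ := by
  simpa [negLog, EReal.toENNReal_eq_top_iff, EReal.neg_eq_top_iff] using ha

lemma negLog_ofReal {r : ℝ} (hr : 0 < r) :
    negLog (ENNReal.ofReal r) = ENNReal.ofReal (-Real.log r) := by
  rw [negLog, ENNReal.log_ofReal_of_pos hr, ← EReal.coe_neg, EReal.toENNReal_of_ne_top (by simp)]
  simp

lemma expNeg_negLog {a : ℝ≥0∞} (ha : a ≤ 1) : expNeg (negLog a) = a := by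
  rw [expNeg, coe_negLog ha, neg_neg, ENNReal.exp_log]

lemma continuous_expNeg : Continuous expNeg :=
  ENNReal.continuous_exp.comp (continuous_neg.comp continuous_coe_ennreal_ereal)

lemma strictAnti_expNeg : StrictAnti expNeg := fun _ _ h =>
  EReal.exp_strictMono (EReal.neg_lt_neg_iff.2 (EReal.coe_ennreal_lt_coe_ennreal_iff.2 h))

lemma expNeg_zero : expNeg 0 = 1 := by simp [expNeg]

lemma expNeg_ne_zero {t : ℝ≥0∞} (ht : t ≠ ⊤) : expNeg t ≠ 0 := by
  simpa [expNeg, EReal.neg_eq_bot_iff] using ht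

lemma expNeg_le_one (t : ℝ≥0∞) : expNeg t ≤ 1 := expNeg_zero ▸ strictAnti_expNeg.antitone zero_le

lemma expNeg_ne_top (t : ℝ≥0∞) : expNeg t ≠ ⊤ := ((expNeg_le_one t).trans_lt ENNReal.one_lt_top).ne

lemma expNeg_add (s t : ℝ≥0∞) : expNeg (s + t) = expNeg s * expNeg t := by
  rw [expNeg, expNeg, expNeg, ← EReal.exp_add, EReal.coe_ennreal_add, EReal.neg_add, sub_eq_add_neg]
  · left; simp
  · right; simp

lemma expNeg_sum {ι : Type*} (s : Finset ι) (f : ι → ℝ≥0∞) :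
    expNeg (∑ i ∈ s, f i) = ∏ i ∈ s, expNeg (f i) := by
  classical
  induction s using Finset.induction_on with
  | empty => simp [expNeg_zero]
  | insert a s ha ih => rw [Finset.sum_insert ha, Finset.prod_insert ha, expNeg_add, ih]

lemma expNeg_rpow (t : ℝ≥0∞) {r : ℝ} (hr : 0 ≤ r) : expNeg t ^ r = expNeg (ENNReal.ofReal r * t) := by
  rw [expNeg, expNeg, ← EReal.exp_mul, EReal.coe_ennreal_mul, EReal.coe_ennreal_ofReal,
    max_eq_left hr, mul_comm, mul_neg]

/-- For a function bounded below by `-d`, the extended integral with respect to a probability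
measure is the Lebesgue integral of the shifted function, shifted back. -/
lemma extIntegral_coe_sub {X : Type*} [MeasurableSpace X] (μ : Measure X) [IsProbabilityMeasure μ]
    {f : X → ℝ≥0∞} (hf : Measurable f) {d : ℝ≥0∞} (hd : d ≠ ⊤) :
    extIntegral μ (fun x => (f x : EReal) - (d : EReal)) = ((∫⁻ x, f x ∂μ : ℝ≥0∞) : EReal) - d := by
  have h1 : ∀ x, ((f x : EReal) - (d : EReal)).toENNReal = f x - d := fun x => by
    rw [EReal.toENNReal_sub (EReal.coe_ennreal_nonneg _), EReal.toENNReal_coe, EReal.toENNReal_coe]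
  have h2 : ∀ x, (-((f x : EReal) - (d : EReal))).toENNReal = d - f x := fun x => by
    rw [EReal.neg_sub (by simp) (by simp [hd]), add_comm, ← sub_eq_add_neg,
      EReal.toENNReal_sub (EReal.coe_ennreal_nonneg _), EReal.toENNReal_coe, EReal.toENNReal_coe]
  simp only [extIntegral, h1, h2]
  -- With truncated subtraction, both sides integrate max(f, d).
  have h3 : ∫⁻ x, (f x - d) ∂μ + d = ∫⁻ x, f x ∂μ + ∫⁻ x, (d - f x) ∂μ := by
    have : d = ∫⁻ _, d ∂μ := by simp
    nth_rewrite 2 [this]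
    rw [← lintegral_add_right _ measurable_const, ← lintegral_add_left hf]
    refine lintegral_congr fun x => ?_
    rw [tsub_add_eq_max, add_tsub_eq_max]
  have h4 : ∫⁻ x, (d - f x) ∂μ ≠ ⊤ := by
    refine ne_top_of_le_ne_top hd ?_
    calc _ ≤ ∫⁻ _, d ∂μ := lintegral_mono fun x => tsub_le_self
      _ = d := by simp
  generalize ∫⁻ x, (f x - d) ∂μ = A at *
  generalize ∫⁻ x, (d - f x) ∂μ = B at *
  generalize ∫⁻ x, f x ∂μ = D at *
  lift d to NNReal using hd
  lift B to NNReal using h4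
  induction A with
  | top =>
    induction D with
    | top => simp
    | coe D => simp at h3; exact absurd h3.symm (by simp [← ENNReal.coe_add])
  | coe A =>
    induction D with
    | top => simp at h3
    | coe D =>
      norm_cast at h3
      have h5 : (A : ℝ) + d = D + B := by exact_mod_cast h3
      have h6 : (A : ℝ) - B = D - d := by linarith
      simp only [EReal.coe_nnreal_eq_coe_real]
      exact_mod_cast congrArg (fun r : ℝ => (r : EReal)) h6

end

/-! ### The logarithmic kernel as a mixture of Gaussians. -/

section LogKernel

variable {V : Type*} [NormedAddCommGroup V] {K : Set V}

/-- The kernel `log (R / |x - y|)`, which is nonnegative on sets of diameter at most `R`. -/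
def logKernel {X : Type*} [PseudoEMetricSpace X] (R : ℝ≥0∞) (p : X × X) : ℝ≥0∞ :=
  negLog (edist p.1 p.2 / R)

lemma continuous_logKernel {X : Type*} [PseudoEMetricSpace X] {R : ℝ≥0∞} (hR : R ≠ 0) :
    Continuous (logKernel (X := X) R) :=
  continuous_negLog.comp ((ENNReal.continuous_div_const R hR).comp continuous_edist)

/-- Frullani's integral with endpoints |x-y|² and R²; the squares account for the factor 2. On the
diagonal both sides are infinite. -/
lemma two_mul_logKernel {X : Type*} [PseudoMetricSpace X] {R : ℝ} (hR : 0 < R) {p : X × X}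
    (hp : dist p.1 p.2 ≤ R) :
    2 * logKernel (ENNReal.ofReal R) p = ∫⁻ t in Set.Ioi (0 : ℝ), ENNReal.ofReal
      ((Real.exp (-t * dist p.1 p.2 ^ 2) - Real.exp (-t * R ^ 2)) / t) := by
  rw [lintegral_exp_sub_exp_div (by positivity) (by gcongr), logKernel, edist_dist]
  rcases (dist_nonneg : 0 ≤ dist p.1 p.2).eq_or_lt with h | h
  · rw [← h, zero_pow two_ne_zero, lintegral_inv_Ioc_zero (by positivity)]
    simp [negLog_zero]
  · rw [lintegral_inv_Ioc (by positivity) (by gcongr), ← ENNReal.ofReal_div_of_pos hR,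
      negLog_ofReal (by positivity), show (2 : ℝ≥0∞) = ENNReal.ofReal 2 by simp,
      ← ENNReal.ofReal_mul (by norm_num), ← div_pow, Real.log_pow, ← Real.log_inv, inv_div]
    norm_num

variable [InnerProductSpace ℝ V] [FiniteDimensional ℝ V] [MeasurableSpace V] [BorelSpace V]

lemma integral_gaussian_map_val (t : ℝ) (μ ν : Measure K)
    [IsProbabilityMeasure μ] [IsProbabilityMeasure ν] :
    ∫ p : V × V, Real.exp (-t * ‖p.1 - p.2‖ ^ 2) ∂((μ.map Subtype.val).prod (ν.map Subtype.val))
      = ∫ p : K × K, Real.exp (-t * dist p.1 p.2 ^ 2) ∂(μ.prod ν) := by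
  rw [Measure.map_prod_map _ _ measurable_subtype_coe measurable_subtype_coe, integral_map]
  · refine integral_congr_ae (Eventually.of_forall fun p => ?_)
    simp [Subtype.dist_eq, dist_eq_norm]
  · exact (measurable_subtype_coe.prodMap measurable_subtype_coe).aemeasurable
  · exact Continuous.aestronglyMeasurable (by fun_prop)

/-- The logarithmic energy is strictly conditionally positive definite. -/
lemma eq_of_logKernel_le (hK : MeasurableSet K) {R : ℝ} (hR : 0 < R)
    (hKR : ∀ x y : K, dist x y ≤ R) (μ ν : Measure K) [IsProbabilityMeasure μ]
    [IsProbabilityMeasure ν]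
    (hμ : ∫⁻ p, logKernel (ENNReal.ofReal R) p ∂(μ.prod μ) ≠ ⊤)
    (hν : ∫⁻ p, logKernel (ENNReal.ofReal R) p ∂(ν.prod ν) ≠ ⊤)
    (hle : ∫⁻ p, logKernel (ENNReal.ofReal R) p ∂(μ.prod μ) +
      ∫⁻ p, logKernel (ENNReal.ofReal R) p ∂(ν.prod ν)
        ≤ 2 * ∫⁻ p, logKernel (ENNReal.ofReal R) p ∂(μ.prod ν)) : μ = ν := by
  let Φ : Measure K → Measure K → ℝ → ℝ≥0∞ := fun μ ν t =>
    ∫⁻ p, ENNReal.ofReal ((Real.exp (-t * dist p.1 p.2 ^ 2) - Real.exp (-t * R ^ 2)) / t) ∂(μ.prod ν)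
  let G : Measure K → Measure K → ℝ → ℝ := fun μ ν t =>
    ∫ p : K × K, Real.exp (-t * dist p.1 p.2 ^ 2) ∂(μ.prod ν)
  have hmeas : Measurable fun q : ℝ × (K × K) => ENNReal.ofReal
      ((Real.exp (-q.1 * dist q.2.1 q.2.2 ^ 2) - Real.exp (-q.1 * R ^ 2)) / q.1) := by
    fun_prop
  have hΦm : ∀ (μ ν : Measure K) [IsProbabilityMeasure μ] [IsProbabilityMeasure ν],
      Measurable (Φ μ ν) := fun μ ν _ _ => hmeas.lintegral_prod_right'
  have hΦ : ∀ (μ ν : Measure K) [IsProbabilityMeasure μ] [IsProbabilityMeasure ν],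
      2 * ∫⁻ p, logKernel (ENNReal.ofReal R) p ∂(μ.prod ν) = ∫⁻ t in Set.Ioi (0 : ℝ), Φ μ ν t := by
    intro μ ν _ _
    rw [← lintegral_const_mul _ (continuous_logKernel (by simpa using hR)).measurable,
      lintegral_congr fun p : K × K => two_mul_logKernel hR (hKR p.1 p.2)]
    exact lintegral_lintegral_swap (hmeas.comp measurable_swap).aemeasurable
  have hint : ∀ (μ ν : Measure K) [IsProbabilityMeasure μ] [IsProbabilityMeasure ν] (t : ℝ), 0 < t →
      Integrable (fun p : K × K => Real.exp (-t * dist p.1 p.2 ^ 2)) (μ.prod ν) := by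
    intro μ ν _ _ t ht
    refine (integrable_const (1 : ℝ)).mono (Continuous.aestronglyMeasurable (by fun_prop))
      (Eventually.of_forall fun p => ?_)
    rw [Real.norm_of_nonneg (Real.exp_pos _).le, norm_one, Real.exp_le_one_iff]
    nlinarith [sq_nonneg (dist p.1 p.2)]
  have hle' : ∀ (t : ℝ), 0 < t → ∀ p : K × K,
      Real.exp (-t * R ^ 2) ≤ Real.exp (-t * dist p.1 p.2 ^ 2) := by
    intro t ht p
    have : dist p.1 p.2 ^ 2 ≤ R ^ 2 := by gcongr; exact hKR _ _
    exact Real.exp_le_exp.2 (by nlinarith)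
  have hG : ∀ (μ ν : Measure K) [IsProbabilityMeasure μ] [IsProbabilityMeasure ν] (t : ℝ), 0 < t →
      Real.exp (-t * R ^ 2) ≤ G μ ν t ∧
        Φ μ ν t = ENNReal.ofReal ((G μ ν t - Real.exp (-t * R ^ 2)) / t) := by
    intro μ ν _ _ t ht
    constructor
    · calc _ = ∫ _p : K × K, Real.exp (-t * R ^ 2) ∂(μ.prod ν) := by simp
        _ ≤ _ := integral_mono (integrable_const _) (hint μ ν t ht) fun p => hle' t ht p
    · simp only [Φ, G]
      have hi : Integrable (fun p : K × K =>
          (Real.exp (-t * dist p.1 p.2 ^ 2) - Real.exp (-t * R ^ 2)) / t) (μ.prod ν) :=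
        ((hint μ ν t ht).sub (integrable_const _)).div_const t
      rw [← ofReal_integral_eq_lintegral_ofReal hi
        (Eventually.of_forall fun p => div_nonneg (sub_nonneg.2 (hle' t ht p)) ht.le),
        integral_div, integral_sub (hint μ ν t ht) (integrable_const _)]
      simp
  have hmap : ∀ (μ : Measure K) [IsProbabilityMeasure μ],
      IsProbabilityMeasure (μ.map (Subtype.val : K → V)) := fun μ _ =>
    Measure.isProbabilityMeasure_map measurable_subtype_coe.aemeasurable
  have := hmap μ
  have := hmap ν
  have hsum : ∀ t : ℝ, 0 < t → Φ μ μ t + Φ ν ν t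
      = ENNReal.ofReal ((G μ μ t + G ν ν t - 2 * Real.exp (-t * R ^ 2)) / t) := by
    intro t ht
    obtain ⟨h1, h2⟩ := hG μ μ t ht
    obtain ⟨h3, h4⟩ := hG ν ν t ht
    rw [h2, h4, ← ENNReal.ofReal_add (div_nonneg (sub_nonneg.2 h1) ht.le)
      (div_nonneg (sub_nonneg.2 h3) ht.le)]
    congr 1
    ring
  have htwo : ∀ t : ℝ, 0 < t → 2 * Φ μ ν t
      = ENNReal.ofReal ((2 * G μ ν t - 2 * Real.exp (-t * R ^ 2)) / t) := by
    intro t ht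
    rw [(hG μ ν t ht).2, show (2 : ℝ≥0∞) = ENNReal.ofReal 2 by simp,
      ← ENNReal.ofReal_mul (by norm_num)]
    congr 1
    ring
  have hpt : (fun t => 2 * Φ μ ν t) ≤ᵐ[volume.restrict (Set.Ioi (0 : ℝ))]
      fun t => Φ μ μ t + Φ ν ν t := by
    filter_upwards [ae_restrict_mem measurableSet_Ioi] with t ht
    rw [hsum t ht, htwo t ht]
    have h := two_mul_gaussian_le ht (μ.map (Subtype.val : K → V)) (ν.map Subtype.val)
    simp only [integral_gaussian_map_val] at h
    refine ENNReal.ofReal_le_ofReal ?_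
    gcongr
    · exact (Set.mem_Ioi.1 ht).le
  have hI : ∫⁻ t in Set.Ioi (0 : ℝ), (Φ μ μ t + Φ ν ν t)
      = 2 * (∫⁻ p, logKernel (ENNReal.ofReal R) p ∂(μ.prod μ) +
      ∫⁻ p, logKernel (ENNReal.ofReal R) p ∂(ν.prod ν)) := by
    rw [lintegral_add_left (hΦm μ μ), ← hΦ, ← hΦ, mul_add]
  have hJ : ∫⁻ t in Set.Ioi (0 : ℝ), 2 * Φ μ ν t
      = 2 * (2 * ∫⁻ p, logKernel (ENNReal.ofReal R) p ∂(μ.prod ν)) := by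
    rw [lintegral_const_mul _ (hΦm μ ν), hΦ]
  have hIle : ∫⁻ t in Set.Ioi (0 : ℝ), (Φ μ μ t + Φ ν ν t) ≤ ∫⁻ t in Set.Ioi (0 : ℝ), 2 * Φ μ ν t := by
    rw [hI, hJ]
    gcongr
  have hfin : ∫⁻ t in Set.Ioi (0 : ℝ), 2 * Φ μ ν t ≠ ⊤ :=
    ne_top_of_le_ne_top (hI ▸ ENNReal.mul_ne_top (by simp) (ENNReal.add_ne_top.2 ⟨hμ, hν⟩))
      (lintegral_mono_ae hpt)
  -- The Gaussian inequality holds for every t > 0, while the integrals over t satisfy the reverse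
  -- one. Being finite, they force equality for almost every t, and a single such t suffices.
  have hae := ae_eq_of_ae_le_of_lintegral_le hpt hfin
    ((hΦm μ μ).add (hΦm ν ν)).aemeasurable hIle
  have : NeBot (ae (volume.restrict (Set.Ioi (0 : ℝ)))) := by
    rw [ae_neBot, ne_eq, Measure.restrict_eq_zero]
    simp
  obtain ⟨t, ht1, ht2⟩ := (hae.and (ae_restrict_mem measurableSet_Ioi)).exists
  simp only [hsum t ht2, htwo t ht2] at ht1
  have ht0 : 0 < t := ht2
  have hnn : 0 ≤ (2 * G μ ν t - 2 * Real.exp (-t * R ^ 2)) / t :=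
    div_nonneg (by linarith [(hG μ ν t ht0).1]) ht0.le
  have hnn' : 0 ≤ (G μ μ t + G ν ν t - 2 * Real.exp (-t * R ^ 2)) / t :=
    div_nonneg (by linarith [(hG μ μ t ht0).1, (hG ν ν t ht0).1]) ht0.le
  have heq := (ENNReal.ofReal_eq_ofReal_iff hnn hnn').1 ht1
  rw [div_left_inj' ht0.ne'] at heq
  have hfinal : μ.map (Subtype.val : K → V) = ν.map Subtype.val := by
    refine eq_of_gaussian_le ht0 _ _ ?_
    simp only [integral_gaussian_map_val]
    simp only [G] at heq
    linarith
  rw [← (MeasurableEmbedding.subtype_coe hK).comap_map μ, hfinal,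
    (MeasurableEmbedding.subtype_coe hK).comap_map]

end LogKernel

/-! ### Vandermonde products, partition functions and large deviations. -/

section Vandermonde

lemma measurable_pairSum {X : Type*} [MeasurableSpace X] {H : X × X → ℝ≥0∞}
    (hm : Measurable H) (k : ℕ) :
    Measurable fun x : Fin k → X => pairSum H x :=
  Finset.measurable_sum _ fun i _ => Finset.measurable_sum _ fun j _ => hm.comp (by fun_prop)

lemma measurable_pairMean {X : Type*} [MeasurableSpace X] {H : X × X → ℝ≥0∞}
    (hm : Measurable H) (k : ℕ) :
    Measurable fun x : Fin k → X => pairMean H x :=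
  (measurable_pairSum hm k).const_mul _


variable {X : Type*} [PseudoEMetricSpace X] {Q : X → EReal} {H : X × X → ℝ≥0∞} {C : ℝ≥0∞}

lemma vdm_eq (hH : ∀ x y, edist x y * weight Q x * weight Q y = C * expNeg (H (x, y))) {k : ℕ}
    (x : Fin k → X) :
    vdm Q x = C ^ (∑ i : Fin k, (Finset.Ioi i).card) * expNeg (pairSum H x) := by
  simp only [vdm, hH, Finset.prod_mul_distrib, Finset.prod_const, Finset.prod_pow_eq_pow_sum,
    pairSum, expNeg_sum]

/-- The exponent is the reciprocal of the number of pairs, so each pair contributes a single C in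
total mean and the sum of H becomes its mean. -/
lemma vdm_rpow (hH : ∀ x y, edist x y * weight Q x * weight Q y = C * expNeg (H (x, y))) {k : ℕ}
    (hk : 2 ≤ k) (x : Fin k → X) :
    vdm Q x ^ (2 / ((k : ℝ) * ((k : ℝ) - 1))) = C * expNeg (pairMean H x) := by
  have hkr : (2 : ℝ) ≤ k := by exact_mod_cast hk
  have hp : 0 < (k : ℝ) * ((k : ℝ) - 1) := by nlinarith
  rw [vdm_eq hH, ENNReal.mul_rpow_of_nonneg _ _ (by positivity), expNeg_rpow _ (by positivity),
    ← ENNReal.rpow_natCast, ← ENNReal.rpow_mul, sum_card_Ioi, div_mul_div_cancel₀ two_ne_zero,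
    div_self hp.ne', ENNReal.rpow_one, pairMean]

lemma diameter_eq (hH : ∀ x y, edist x y * weight Q x * weight Q y = C * expNeg (H (x, y))) {k : ℕ}
    (hk : 2 ≤ k) : diameter Q k = C * expNeg (⨅ x : Fin k → X, pairMean H x) := by
  simp only [diameter, vdm_rpow hH hk]
  rw [← ENNReal.mul_iSup, strictAnti_expNeg.antitone.map_iInf_of_continuousAt
    continuous_expNeg.continuousAt (by simp [expNeg])]
  rfl

lemma vdm_succ_eq_zero {k : ℕ} (x : Fin (k + 1) → X) (h : vdm Q (fun i : Fin k => x i.succ) = 0) :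
    vdm Q x = 0 := by
  rw [vdm, Fin.prod_univ_succ]
  simp only [Fin.prod_Ioi_succ]
  rw [vdm] at h
  rw [h, mul_zero]

variable [MeasurableSpace X]

lemma weightedEnergy_eq (hH : ∀ x y, edist x y * weight Q x * weight Q y = C * expNeg (H (x, y)))
    (hm : Measurable H) (hC : 1 ≤ C) (hC' : C ≠ ⊤) (μ : Measure X) [IsProbabilityMeasure μ] :
    weightedEnergy Q μ = (kernelEnergy H μ : EReal) - ENNReal.log C := by
  have hd : ((ENNReal.log C).toENNReal : EReal) = ENNReal.log C :=
    EReal.coe_toENNReal (by simpa using hC)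
  have hd' : (ENNReal.log C).toENNReal ≠ ⊤ := by
    simpa [EReal.toENNReal_eq_top_iff] using hC'
  rw [kernelEnergy, ← hd, ← extIntegral_coe_sub _ hm hd', weightedEnergy]
  congr 1
  ext p
  rw [hH, ENNReal.log_mul_add, expNeg, EReal.log_exp, hd, EReal.neg_add, sub_eq_add_neg, neg_neg, add_comm,
    ← sub_eq_add_neg]
  · left
    simpa using (zero_lt_one.trans_le hC).ne'
  · left
    simpa using hC'

lemma minEnergy_eq (hH : ∀ x y, edist x y * weight Q x * weight Q y = C * expNeg (H (x, y)))
    (hm : Measurable H) (hC : 1 ≤ C) (hC' : C ≠ ⊤) {μ : ProbabilityMeasure X}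
    (hμ : kernelEnergy H (μ : Measure X)
      = ⨅ ρ : ProbabilityMeasure X, kernelEnergy H (ρ : Measure X)) :
    minEnergy Q = ((⨅ ρ : ProbabilityMeasure X, kernelEnergy H (ρ : Measure X) : ℝ≥0∞) : EReal)
      - ENNReal.log C := by
  refine le_antisymm ?_ (le_iInf fun ρ => ?_)
  · rw [← hμ, ← weightedEnergy_eq hH hm hC hC']
    exact iInf_le _ μ
  · rw [weightedEnergy_eq hH hm hC hC']
    exact EReal.sub_le_sub (EReal.coe_ennreal_le_coe_ennreal_iff.2 (iInf_le _ ρ)) le_rfl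

lemma exp_neg_sub_log (hC' : C ≠ ⊤) (t : ℝ≥0∞) :
    EReal.exp (-((t : EReal) - ENNReal.log C)) = C * expNeg t := by
  rw [EReal.neg_sub, EReal.exp_add, ENNReal.exp_log, mul_comm, expNeg]
  · left; simp
  · right; simpa using hC'

lemma measurable_vdm (hH : ∀ x y, edist x y * weight Q x * weight Q y = C * expNeg (H (x, y)))
    (hm : Measurable H) (k : ℕ) : Measurable fun x : Fin k → X => vdm Q x := by
  simp only [vdm_eq hH]
  exact (continuous_expNeg.measurable.comp (measurable_pairSum hm k)).const_mul _

lemma partitionFunction_ne_top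
    (hH : ∀ x y, edist x y * weight Q x * weight Q y = C * expNeg (H (x, y)))
    (hC' : C ≠ ⊤) (ν : Measure X) [IsFiniteMeasure ν] (k : ℕ) : partitionFunction Q ν k ≠ ⊤ := by
  have hle : ∀ x : Fin k → X, vdm Q x ^ 2 ≤ (C ^ (∑ i : Fin k, (Finset.Ioi i).card)) ^ 2 := by
    intro x
    rw [vdm_eq hH]
    gcongr
    exact mul_le_of_le_one_right' (expNeg_le_one _)
  refine ne_top_of_le_ne_top ?_ (lintegral_mono hle)
  rw [lintegral_const]
  exact ENNReal.mul_ne_top (ENNReal.pow_ne_top (ENNReal.pow_ne_top hC')) (measure_ne_top _ _)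

/-- The Vandermonde of k+1 points contains that of the last k as a factor. Hence one zero partition
function would make all later ones, and the limit, vanish. -/
lemma partitionFunction_succ_eq_zero
    (hH : ∀ x y, edist x y * weight Q x * weight Q y = C * expNeg (H (x, y)))
    (hm : Measurable H) (ν : Measure X) [IsFiniteMeasure ν] {k : ℕ}
    (h : partitionFunction Q ν k = 0) : partitionFunction Q ν (k + 1) = 0 := by
  rw [partitionFunction, lintegral_eq_zero_iff ((measurable_vdm hH hm _).pow_const 2)] at h ⊢
  have hmp := measurePreserving_piFinSuccAbove (fun _ : Fin (k + 1) => ν) 0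
  have h2 := (Measure.quasiMeasurePreserving_snd (μ := ν)
    (ν := Measure.pi fun _ : Fin k => ν)).ae h
  filter_upwards [hmp.quasiMeasurePreserving.ae h2] with x hx
  have hx' : vdm Q (fun i : Fin k => x i.succ) ^ 2 = 0 := hx
  have := vdm_succ_eq_zero x (pow_eq_zero_iff two_ne_zero |>.1 hx')
  simp [this]

lemma isProbabilityMeasure_vdmEnsemble (ν : Measure X) (k : ℕ) (h0 : partitionFunction Q ν k ≠ 0)
    (h1 : partitionFunction Q ν k ≠ ⊤) : IsProbabilityMeasure (vdmEnsemble Q ν k) := by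
  refine ⟨?_⟩
  rw [vdmEnsemble, Measure.smul_apply, withDensity_apply _ MeasurableSet.univ,
    Measure.restrict_univ, smul_eq_mul]
  exact ENNReal.inv_mul_cancel h0 h1

lemma partitionFunction_ne_zero
    (hH : ∀ x y, edist x y * weight Q x * weight Q y = C * expNeg (H (x, y)))
    (hm : Measurable H) (ν : Measure X) [IsFiniteMeasure ν] {δ : ℝ≥0∞} (hδ : δ ≠ 0)
    (hlim : Tendsto (fun k : ℕ => partitionFunction Q ν k ^ (1 / ((k : ℝ) * ((k : ℝ) - 1)))) atTop
      (𝓝 δ)) (k : ℕ) : partitionFunction Q ν k ≠ 0 := by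
  intro h0
  have h1 : ∀ j, k ≤ j → partitionFunction Q ν j = 0 := fun j hj => by
    induction j, hj using Nat.le_induction with
    | base => exact h0
    | succ j _ ih => exact partitionFunction_succ_eq_zero hH hm ν ih
  refine hδ (tendsto_nhds_unique hlim (tendsto_const_nhds.congr' ?_))
  filter_upwards [eventually_ge_atTop (max k 2)] with j hj
  have hj2 : (2 : ℝ) ≤ j := by exact_mod_cast (le_max_right _ _).trans hj
  rw [h1 j ((le_max_left _ _).trans hj), ENNReal.zero_rpow_of_pos]
  have : 0 < (j : ℝ) * ((j : ℝ) - 1) := by nlinarith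
  positivity

lemma vdmEnsemble_apply_le
    (hH : ∀ x y, edist x y * weight Q x * weight Q y = C * expNeg (H (x, y)))
    (hm : Measurable H) (ν : Measure X) [IsFiniteMeasure ν] (c : ℝ≥0∞) {k : ℕ} (hk : 1 ≤ k) :
    vdmEnsemble Q ν (k + 1) {x | c < pairMean H x}
      ≤ (partitionFunction Q ν (k + 1))⁻¹ *
        ((C * expNeg c) ^ ((k + 1) * k) * ν Set.univ ^ (k + 1)) := by
  have hS : MeasurableSet {x : Fin (k + 1) → X | c < pairMean H x} :=
    measurableSet_lt measurable_const (measurable_pairMean hm _)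
  rw [vdmEnsemble, Measure.smul_apply, withDensity_apply _ hS, smul_eq_mul]
  gcongr
  have hle : ∀ x ∈ {x : Fin (k + 1) → X | c < pairMean H x},
      vdm Q x ^ 2 ≤ (C * expNeg c) ^ ((k + 1) * k) := by
    intro x hx
    have hkr : (1 : ℝ) ≤ k := by exact_mod_cast hk
    have h1 : vdm Q x ^ 2 = (C * expNeg (pairMean H x)) ^ ((k + 1) * k) := by
      rw [← vdm_rpow hH (by omega), ← ENNReal.rpow_natCast (vdm Q x ^ _), ← ENNReal.rpow_mul,
        ← ENNReal.rpow_natCast]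
      congr 1
      push_cast
      rw [add_sub_cancel_right, div_mul_cancel₀ _ (by positivity)]
    rw [h1]
    gcongr
    exact strictAnti_expNeg.antitone (le_of_lt hx)
  refine (setLIntegral_mono' hS hle).trans ?_
  rw [setLIntegral_const]
  gcongr
  refine (measure_mono (Set.subset_univ _)).trans (le_of_eq ?_)
  rw [Measure.pi_univ]
  simp

/-- Along almost every array the mean energies are asymptotically minimal. -/
lemma ae_eventually_pairMean_le
    (hH : ∀ x y, edist x y * weight Q x * weight Q y = C * expNeg (H (x, y)))
    (hm : Measurable H) (hC : C ≠ 0) (hC' : C ≠ ⊤) (ν : Measure X) [IsFiniteMeasure ν] {v : ℝ≥0∞}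
    (hv : v ≠ ⊤)
    (hlim : Tendsto (fun k : ℕ => partitionFunction Q ν k ^ (1 / ((k : ℝ) * ((k : ℝ) - 1)))) atTop
      (𝓝 (C * expNeg v))) {c : ℝ≥0∞} (hc : v < c) :
    ∀ᵐ Y ∂(arrayLaw Q ν), ∀ᶠ k in atTop, pairMean H (Y k) ≤ c := by
  have hZ0 := partitionFunction_ne_zero hH hm ν (mul_ne_zero hC (expNeg_ne_zero hv)) hlim
  have hZt := partitionFunction_ne_top hH hC' ν
  -- Needed for the array law to have the ensembles as its marginals.
  have hprob : ∀ k : ℕ, IsProbabilityMeasure (vdmEnsemble Q ν (k + 1)) := fun k =>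
    isProbabilityMeasure_vdmEnsemble ν _ (hZ0 _) (hZt _)
  -- The level c' leaves room on both sides: eventually Z is at least b^((k+1)k), while the
  -- integrand on the bad event is at most a^((k+1)k) with a < b.
  obtain ⟨c', hvc', hcc'⟩ := exists_between hc
  have hc't : c' ≠ ⊤ := (hcc'.trans_le le_top).ne
  set a := C * expNeg c with ha
  set b := C * expNeg c' with hb
  have hab : a < b := ENNReal.mul_lt_mul_right hC hC' (strictAnti_expNeg hcc')
  have hbδ : b < C * expNeg v := ENNReal.mul_lt_mul_right hC hC' (strictAnti_expNeg hvc')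
  have hb0 : b ≠ 0 := mul_ne_zero hC (expNeg_ne_zero hc't)
  have hbt : b ≠ ⊤ := ENNReal.mul_ne_top hC' (expNeg_ne_top _)
  have hr : a / b < 1 := (ENNReal.div_lt_iff (Or.inl hb0) (Or.inl hbt)).2 (by simpa using hab)
  -- The factor ν(K)^(k+1) is absorbed since ((a/b)^k ν(K))^(k+1) has base below 1/2.
  have hsmall : ∀ᶠ k : ℕ in atTop, (a / b) ^ k * ν Set.univ < 2⁻¹ := by
    have h1 : Tendsto (fun k : ℕ => (a / b) ^ k * ν Set.univ) atTop (𝓝 (0 * ν Set.univ)) :=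
      ENNReal.Tendsto.mul_const (ENNReal.tendsto_pow_atTop_nhds_zero_of_lt_one hr)
        (Or.inr (measure_ne_top ν _))
    rw [zero_mul] at h1
    exact h1.eventually (gt_mem_nhds (by simp))
  have hZlarge : ∀ᶠ k : ℕ in atTop, b ^ ((k + 1) * k) ≤ partitionFunction Q ν (k + 1) := by
    have h1 := (tendsto_add_atTop_iff_nat 1).2 hlim
    filter_upwards [h1.eventually (lt_mem_nhds hbδ), eventually_ge_atTop 1] with k hk hk1
    have hkr : (1 : ℝ) ≤ k := by exact_mod_cast hk1
    calc b ^ ((k + 1) * k) ≤ (partitionFunction Q ν (k + 1) ^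
          (1 / (((k + 1 : ℕ) : ℝ) * (((k + 1 : ℕ) : ℝ) - 1)))) ^ ((k + 1) * k) := by gcongr
      _ = partitionFunction Q ν (k + 1) := by
          rw [← ENNReal.rpow_natCast, ← ENNReal.rpow_mul]
          push_cast
          rw [add_sub_cancel_right, div_mul_cancel₀ _ (by positivity), ENNReal.rpow_one]
  obtain ⟨N, hN⟩ := eventually_atTop.1 (hsmall.and (hZlarge.and (eventually_ge_atTop 1)))
  have hbound : ∀ k : ℕ, arrayLaw Q ν {Y | N ≤ k ∧ c < pairMean H (Y k)} ≤ 2⁻¹ ^ (k + 1) := by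
    intro k
    by_cases hk : N ≤ k
    · obtain ⟨h1, h2, h3⟩ := hN k hk
      have hS : MeasurableSet {x : Fin (k + 1) → X | c < pairMean H x} :=
        measurableSet_lt measurable_const (measurable_pairMean hm _)
      have hpre : {Y : ∀ k : ℕ, Fin (k + 1) → X | N ≤ k ∧ c < pairMean H (Y k)}
          = Function.eval k ⁻¹' {x | c < pairMean H x} := by
        ext Y; simp [hk]
      rw [hpre, arrayLaw, (measurePreserving_eval_infinitePi
        (fun k : ℕ => vdmEnsemble Q ν (k + 1)) k).measure_preimage hS.nullMeasurableSet]
      calc _ ≤ (partitionFunction Q ν (k + 1))⁻¹ *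
            (a ^ ((k + 1) * k) * ν Set.univ ^ (k + 1)) := vdmEnsemble_apply_le hH hm ν c h3
        _ ≤ (b ^ ((k + 1) * k))⁻¹ * (a ^ ((k + 1) * k) * ν Set.univ ^ (k + 1)) := by gcongr
        _ = ((a / b) ^ k * ν Set.univ) ^ (k + 1) := by
            rw [mul_pow ((a / b) ^ k), ← pow_mul, div_eq_mul_inv, mul_pow a b⁻¹, ENNReal.inv_pow,
              mul_comm k (k + 1)]
            ring
        _ ≤ _ := by gcongr
    · simp [hk]
  have hsum : ∑' k : ℕ, arrayLaw Q ν {Y | N ≤ k ∧ c < pairMean H (Y k)} ≠ ⊤ := by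
    refine ne_top_of_le_ne_top ?_ (ENNReal.tsum_le_tsum hbound)
    simp_rw [pow_succ]
    rw [ENNReal.tsum_mul_right, ENNReal.tsum_geometric]
    simp
  filter_upwards [ae_eventually_notMem hsum] with Y hY
  filter_upwards [hY, eventually_ge_atTop N] with k hk hkN
  by_contra! hcon
  exact hk ⟨hkN, hcon⟩

end Vandermonde

/-! ### Comparison of minimizers and existence of finite energy. -/

section Minimizers

variable {X : Type*} [MeasurableSpace X]

lemma kernelEnergy_add_field {L : X × X → ℝ≥0∞} {q : X → ℝ≥0∞} (hq : Measurable q)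
    (μ : Measure X) [IsProbabilityMeasure μ] :
    kernelEnergy (fun p => L p + q p.1 + q p.2) μ = ∫⁻ p, L p ∂(μ.prod μ) + 2 * ∫⁻ x, q x ∂μ := by
  have h1 : ∫⁻ p, q p.1 ∂(μ.prod μ) = ∫⁻ x, q x ∂μ :=
    (measurePreserving_fst (μ := μ) (ν := μ)).lintegral_comp hq
  have h2 : ∫⁻ p, q p.2 ∂(μ.prod μ) = ∫⁻ x, q x ∂μ :=
    (measurePreserving_snd (μ := μ) (ν := μ)).lintegral_comp hq
  rw [kernelEnergy, lintegral_add_right _ (by fun_prop), lintegral_add_right _ (by fun_prop), h1, h2,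
    two_mul, add_assoc]

/-- The mutual energy of two minimizers dominates the mean of their self-energies. -/
lemma add_le_two_mul_of_minimizers {L : X × X → ℝ≥0∞} {q : X → ℝ≥0∞}
    (hq : Measurable q) (hs : ∀ x y, L (x, y) = L (y, x)) {v : ℝ≥0∞} (hv : v ≠ ⊤)
    (hmin : ∀ ρ : ProbabilityMeasure X,
      v ≤ kernelEnergy (fun p => L p + q p.1 + q p.2) (ρ : Measure X))
    (μ ν : Measure X) [IsProbabilityMeasure μ] [IsProbabilityMeasure ν]
    (hμ : kernelEnergy (fun p => L p + q p.1 + q p.2) μ = v)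
    (hν : kernelEnergy (fun p => L p + q p.1 + q p.2) ν = v) :
    ∫⁻ p, L p ∂(μ.prod μ) ≠ ⊤ ∧ ∫⁻ p, L p ∂(ν.prod ν) ≠ ⊤ ∧
      ∫⁻ p, L p ∂(μ.prod μ) + ∫⁻ p, L p ∂(ν.prod ν) ≤ 2 * ∫⁻ p, L p ∂(μ.prod ν) := by
  -- The field terms are affine in the measure and cancel when the midpoint is compared with the two
  -- minimizers.
  let ρ : Measure X := (2⁻¹ : ℝ≥0∞) • (μ + ν)
  have hρ : IsProbabilityMeasure ρ := ⟨by
    simp only [ρ, Measure.smul_apply, Measure.add_apply, measure_univ, smul_eq_mul]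
    rw [one_add_one_eq_two, ENNReal.inv_mul_cancel two_ne_zero ENNReal.ofNat_ne_top]⟩
  have hsymm : ∫⁻ p, L p ∂(ν.prod μ) = ∫⁻ p, L p ∂(μ.prod ν) := by
    rw [← lintegral_prod_swap]
    exact lintegral_congr fun p => hs _ _
  have hLρ : ∫⁻ p, L p ∂(ρ.prod ρ) = 2⁻¹ * (2⁻¹ * (∫⁻ p, L p ∂(μ.prod μ) +
      2 * ∫⁻ p, L p ∂(μ.prod ν) + ∫⁻ p, L p ∂(ν.prod ν))) := by
    simp only [ρ, Measure.prod_smul_left, Measure.prod_smul_right, Measure.add_prod,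
      Measure.prod_add, lintegral_smul_measure, lintegral_add_measure, smul_eq_mul, hsymm]
    ring
  have hqρ : ∫⁻ x, q x ∂ρ = 2⁻¹ * (∫⁻ x, q x ∂μ + ∫⁻ x, q x ∂ν) := by
    simp only [ρ, lintegral_smul_measure, lintegral_add_measure, smul_eq_mul]
  have h1 := hmin ⟨ρ, hρ⟩
  rw [ProbabilityMeasure.coe_mk] at h1
  rw [kernelEnergy_add_field hq] at h1 hμ hν
  rw [hLρ, hqρ] at h1
  have hfμ := hμ ▸ hv
  have hfν := hν ▸ hv
  rw [ENNReal.add_ne_top] at hfμ hfν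
  have hqμ : ∫⁻ x, q x ∂μ ≠ ⊤ := fun h => hfμ.2 (by simp [h])
  have hqν : ∫⁻ x, q x ∂ν ≠ ⊤ := fun h => hfν.2 (by simp [h])
  refine ⟨hfμ.1, hfν.1, ?_⟩
  have hfLμ := hfμ.1
  have hfLν := hfν.1
  generalize ∫⁻ p, L p ∂(μ.prod μ) = a at *
  generalize ∫⁻ p, L p ∂(ν.prod ν) = b at *
  generalize ∫⁻ p, L p ∂(μ.prod ν) = m at *
  generalize ∫⁻ x, q x ∂μ = s at *
  generalize ∫⁻ x, q x ∂ν = t at *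
  rcases eq_or_ne m ⊤ with rfl | hm
  · simp [ENNReal.mul_top]
  lift a to NNReal using hfLμ
  lift b to NNReal using hfLν
  lift m to NNReal using hm
  lift s to NNReal using hqμ
  lift t to NNReal using hqν
  lift v to NNReal using hv
  rw [show (2⁻¹ : ℝ≥0∞) = ((2⁻¹ : NNReal) : ℝ≥0∞) by simp] at h1
  norm_cast at h1 hμ hν ⊢
  rw [← NNReal.coe_le_coe] at h1 ⊢
  rw [← NNReal.coe_inj] at hμ hν
  push_cast at h1 hμ hν ⊢
  linarith

/-- A measure of finite interaction energy can be restricted to a set where the field is bounded. -/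
lemma exists_kernelEnergy_ne_top {L : X × X → ℝ≥0∞} {q : X → ℝ≥0∞}
    (hq : Measurable q) (μ : Measure X) [IsProbabilityMeasure μ]
    (hμ : ∫⁻ p, L p ∂(μ.prod μ) ≠ ⊤) (hqμ : ∀ᵐ x ∂μ, q x ≠ ⊤) :
    ∃ ρ : ProbabilityMeasure X,
      kernelEnergy (fun p => L p + q p.1 + q p.2) (ρ : Measure X) ≠ ⊤ := by
  -- The field is finite almost everywhere, so some sublevel set has positive mass. Conditioning on
  -- it bounds the field and multiplies the interaction energy by at most a finite constant.
  have hex : ∃ m : ℕ, μ {x | q x ≤ m} ≠ 0 := by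
    by_contra! hcon
    have h0 : μ (⋃ m : ℕ, {x | q x ≤ m}) = 0 := measure_iUnion_null hcon
    have h1 : ∀ᵐ x ∂μ, x ∉ ⋃ m : ℕ, {x | q x ≤ m} := measure_eq_zero_iff_ae_notMem.1 h0
    have : NeBot (ae μ) := inferInstance
    obtain ⟨x, hx, hx'⟩ := (h1.and hqμ).exists
    obtain ⟨m, hm⟩ := ENNReal.exists_nat_gt hx'
    exact hx (Set.mem_iUnion.2 ⟨m, hm.le⟩)
  obtain ⟨m, hm⟩ := hex
  have hA : MeasurableSet {x | q x ≤ m} := measurableSet_le hq measurable_const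
  have hρ := ProbabilityTheory.cond_isProbabilityMeasure hm
  refine ⟨⟨ProbabilityTheory.cond μ {x | q x ≤ m}, hρ⟩, ?_⟩
  rw [ProbabilityMeasure.coe_mk, kernelEnergy_add_field hq, ENNReal.add_ne_top]
  constructor
  · have hc : (μ {x | q x ≤ m})⁻¹ ≠ ⊤ := ENNReal.inv_ne_top.2 hm
    simp only [ProbabilityTheory.cond, Measure.prod_smul_left, Measure.prod_smul_right,
      lintegral_smul_measure, smul_eq_mul, Measure.prod_restrict]
    exact ENNReal.mul_ne_top hc (ENNReal.mul_ne_top hc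
      (ne_top_of_le_ne_top hμ (setLIntegral_le_lintegral _ _)))
  · refine ENNReal.mul_ne_top ENNReal.ofNat_ne_top ?_
    have hle : ∫⁻ x, q x ∂(ProbabilityTheory.cond μ {x | q x ≤ m})
        ≤ ∫⁻ _, (m : ℝ≥0∞) ∂(ProbabilityTheory.cond μ {x | q x ≤ m}) :=
      lintegral_mono_ae (ProbabilityTheory.ae_cond_mem hA)
    refine ne_top_of_le_ne_top ?_ hle
    simp

end Minimizers

/-! ### The normalized weighted kernel. -/

section WeightKernel

variable {X : Type*} [PseudoEMetricSpace X]

/-- The kernel `log (R M² / (|x - y| w(x) w(y)))`. -/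
def weightKernel (Q : X → EReal) (R M : ℝ≥0∞) (p : X × X) : ℝ≥0∞ :=
  logKernel R p + negLog (weight Q p.1 / M) + negLog (weight Q p.2 / M)

lemma mul_expNeg_negLog_div {a b : ℝ≥0∞} (hab : a ≤ b) (hb : b ≠ 0) (hb' : b ≠ ⊤) :
    b * expNeg (negLog (a / b)) = a := by
  rw [expNeg_negLog (ENNReal.div_le_of_le_mul (by simpa using hab)), ENNReal.mul_div_cancel hb hb']

lemma edist_mul_weight_eq {Q : X → EReal} {R M : ℝ≥0∞} (hR : R ≠ 0) (hR' : R ≠ ⊤) (hM : M ≠ 0)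
    (hM' : M ≠ ⊤) (hKR : ∀ x y : X, edist x y ≤ R) (hw : ∀ x, weight Q x ≤ M) (x y : X) :
    edist x y * weight Q x * weight Q y = R * M * M * expNeg (weightKernel Q R M (x, y)) := by
  rw [weightKernel, expNeg_add, expNeg_add, logKernel]
  nth_rewrite 1 [← mul_expNeg_negLog_div (hKR x y) hR hR', ← mul_expNeg_negLog_div (hw x) hM hM',
    ← mul_expNeg_negLog_div (hw y) hM hM']
  ring

lemma logKernel_comm (R : ℝ≥0∞) (x y : X) : logKernel R (x, y) = logKernel R (y, x) := by
  simp [logKernel, edist_comm]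

lemma weightKernel_comm (Q : X → EReal) (R M : ℝ≥0∞) (x y : X) :
    weightKernel Q R M (x, y) = weightKernel Q R M (y, x) := by
  simp only [weightKernel, logKernel_comm R x y]
  ring

/-- This is a continuous nondecreasing function of Q. -/
lemma lowerSemicontinuous_negLog_weight {Q : X → EReal} (hQ : LowerSemicontinuous Q) {M : ℝ≥0∞}
    (hM : M ≠ 0) : LowerSemicontinuous fun x => negLog (weight Q x / M) := by
  have hc : Continuous fun e : EReal => negLog (EReal.exp (-e) / M) :=
    continuous_negLog.comp ((ENNReal.continuous_div_const M hM).comp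
      (ENNReal.continuous_exp.comp continuous_neg))
  exact hc.comp_lowerSemicontinuous hQ fun a b hab => antitone_negLog
    (ENNReal.div_le_div_right (EReal.exp_monotone (EReal.neg_le_neg_iff.2 hab)) _)

lemma lowerSemicontinuous_weightKernel {Q : X → EReal} (hQ : LowerSemicontinuous Q) {R M : ℝ≥0∞}
    (hR : R ≠ 0) (hM : M ≠ 0) : LowerSemicontinuous (weightKernel Q R M) :=
  ((continuous_logKernel hR).lowerSemicontinuous.add
    ((lowerSemicontinuous_negLog_weight hQ hM).comp continuous_fst)).add
    ((lowerSemicontinuous_negLog_weight hQ hM).comp continuous_snd)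

lemma exists_weight_le [CompactSpace X] {Q : X → EReal} (hQ : LowerSemicontinuous Q)
    (hbot : ∀ x, Q x ≠ ⊥) : ∃ M : ℝ≥0∞, 1 ≤ M ∧ M ≠ ⊤ ∧ ∀ x, weight Q x ≤ M := by
  rcases isEmpty_or_nonempty X with h | h
  · exact ⟨1, le_rfl, ENNReal.one_ne_top, fun x => h.elim x⟩
  · obtain ⟨x₀, -, hx₀⟩ := (hQ.lowerSemicontinuousOn Set.univ).exists_isMinOn Set.univ_nonempty
      isCompact_univ
    refine ⟨max 1 (weight Q x₀), le_max_left _ _, ?_, fun x => le_max_of_le_right ?_⟩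
    · have : weight Q x₀ ≠ ⊤ := by simpa [weight, EReal.neg_eq_top_iff] using hbot x₀
      exact (max_lt ENNReal.one_lt_top this.lt_top).ne
    · exact EReal.exp_monotone (EReal.neg_le_neg_iff.2 (hx₀ (Set.mem_univ x)))

end WeightKernel

/-! ### Finite energy from non-log-polarity. -/

section Euclidean

variable {V : Type*} [NormedAddCommGroup V] [MeasurableSpace V] [BorelSpace V]
  [SecondCountableTopology V] {K : Set V}

lemma logEnergy_eq {X : Type*} [PseudoEMetricSpace X] [MeasurableSpace X]
    [OpensMeasurableSpace (X × X)] {R : ℝ≥0∞} (hR : 1 ≤ R) (hR' : R ≠ ⊤)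
    (hKR : ∀ x y : X, edist x y ≤ R) (μ : Measure X) [IsProbabilityMeasure μ] :
    logEnergy μ = ((∫⁻ p, logKernel R p ∂(μ.prod μ) : ℝ≥0∞) : EReal) - ENNReal.log R := by
  have hR0 : R ≠ 0 := (zero_lt_one.trans_le hR).ne'
  have hd : ((ENNReal.log R).toENNReal : EReal) = ENNReal.log R :=
    EReal.coe_toENNReal (by simpa using hR)
  have hd' : (ENNReal.log R).toENNReal ≠ ⊤ := by
    simpa [EReal.toENNReal_eq_top_iff] using hR'
  rw [← hd, ← extIntegral_coe_sub _ (continuous_logKernel hR0).measurable hd', logEnergy]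
  congr 1
  ext p
  rw [hd, ← mul_expNeg_negLog_div (hKR p.1 p.2) hR0 hR', ENNReal.log_mul_add, expNeg,
    EReal.log_exp, EReal.neg_add, sub_eq_add_neg, neg_neg, add_comm, ← sub_eq_add_neg, logKernel]
  · left
    simpa using hR0
  · left
    simpa using hR'

/-- A compact subset of {Q < ∞} carries a measure of finite logarithmic energy. Pushed forward to
`K`, its field is finite everywhere on the support set, so it can be conditioned to bounded field.
-/
lemma exists_weightKernel_energy_ne_top {Q : K → EReal} (hQ : LowerSemicontinuous Q)
    (hpolar : ¬ IsLogPolar (Subtype.val '' {x : K | Q x < ⊤})) {R M : ℝ≥0∞} (hR : 1 ≤ R)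
    (hR' : R ≠ ⊤) (hM : M ≠ 0) (hM' : M ≠ ⊤) (hKR : ∀ x y : K, edist x y ≤ R) :
    ∃ ρ : ProbabilityMeasure K, kernelEnergy (weightKernel Q R M) (ρ : Measure K) ≠ ⊤ := by
  simp only [IsLogPolar, not_forall] at hpolar
  obtain ⟨C, hC, -, μ, hμ⟩ := hpolar
  have hR0 : R ≠ 0 := (zero_lt_one.trans_le hR).ne'
  have hCK : C ⊆ K := fun x hx => by
    obtain ⟨y, -, rfl⟩ := hC hx
    exact y.2
  have hL : ∫⁻ p, logKernel R p ∂((μ : Measure C).prod μ) ≠ ⊤ := by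
    intro htop
    rw [logEnergy_eq hR hR' (fun x y : C => hKR ⟨x, hCK x.2⟩ ⟨y, hCK y.2⟩), htop] at hμ
    refine hμ ?_
    rw [EReal.coe_ennreal_top, EReal.top_sub]
    simpa using hR'
  have hι : Measurable (Set.inclusion hCK) := measurable_inclusion hCK
  have hprob : IsProbabilityMeasure ((μ : Measure C).map (Set.inclusion hCK)) :=
    Measure.isProbabilityMeasure_map hι.aemeasurable
  have hqm : Measurable fun x : K => negLog (weight Q x / M) :=
    (lowerSemicontinuous_negLog_weight hQ hM).measurable
  refine exists_kernelEnergy_ne_top hqm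
    ((μ : Measure C).map (Set.inclusion hCK)) ?_ ?_
  · rw [Measure.map_prod_map _ _ hι hι, lintegral_map (continuous_logKernel hR0).measurable
      (hι.prodMap hι)]
    exact hL
  · refine (ae_map_iff (p := fun x => negLog (weight Q x / M) ≠ ⊤) hι.aemeasurable
      (hqm (measurableSet_singleton ⊤)).compl).2 ?_
    refine Eventually.of_forall fun x => negLog_ne_top ?_
    obtain ⟨y, hy, hyx⟩ := hC x.2
    have hxy : Set.inclusion hCK x = y := Subtype.ext hyx.symm
    rw [hxy]
    refine (ENNReal.div_pos ?_ hM').ne'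
    simpa [weight, EReal.neg_eq_bot_iff] using hy.ne

end Euclidean

end

end WeightedLogPotential

/-! ### Assembly of the theorem. -/

open WeightedLogPotential in
theorem corollary4p10 {n : ℕ} (K : Set (EuclideanSpace ℝ (Fin n))) (Q : K → EReal)
    (hQ : WeightedLogPotential.Admissible K Q) :
    -- the weighted diameters converge, to `δ^Q(K) = exp (-V_w)`
    Tendsto (fun k : ℕ => WeightedLogPotential.diameter Q k) atTop
        (𝓝 (EReal.exp (-WeightedLogPotential.minEnergy Q))) ∧
      -- `μ` is the weighted equilibrium measure
      ∃ μ : ProbabilityMeasure K, WeightedLogPotential.IsEquilibriumMeasure Q μ ∧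
        ∀ (ν : Measure K) [IsFiniteMeasure ν],
          Tendsto (fun k : ℕ => WeightedLogPotential.partitionFunction Q ν k ^
              (1 / ((k : ℝ) * ((k : ℝ) - 1)))) atTop
            (𝓝 (EReal.exp (-WeightedLogPotential.minEnergy Q))) →
          -- the random array is well defined, and almost surely the empirical measures converge
          (∀ k : ℕ, IsProbabilityMeasure (WeightedLogPotential.vdmEnsemble Q ν (k + 1))) ∧
            ∀ᵐ X ∂(WeightedLogPotential.arrayLaw Q ν),
              Tendsto (fun k : ℕ => WeightedLogPotential.empirical (X k)) atTop (𝓝 μ) := by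
  have : CompactSpace K := isCompact_iff_compactSpace.1 hQ.isCompact
  obtain ⟨M, hM1, hMt, hwM⟩ := exists_weight_le hQ.lowerSemicontinuous hQ.ne_bot
  obtain ⟨r, hr1, hr⟩ : ∃ r : ℝ, 1 ≤ r ∧ ∀ x y : K, dist x y ≤ r := by
    obtain ⟨r, hr⟩ := Metric.isBounded_iff.1 hQ.isCompact.isBounded
    exact ⟨max 1 r, le_max_left _ _, fun x y => le_max_of_le_right (hr x.2 y.2)⟩
  have hr0 : 0 < r := zero_lt_one.trans_le hr1
  have hM0 : M ≠ 0 := (zero_lt_one.trans_le hM1).ne'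
  obtain ⟨R, hRr⟩ : ∃ R, R = ENNReal.ofReal r := ⟨_, rfl⟩
  have hR1 : 1 ≤ R := by simpa [hRr] using hr1
  have hRt : R ≠ ⊤ := by simp [hRr]
  have hR0 : R ≠ 0 := (zero_lt_one.trans_le hR1).ne'
  have hKR : ∀ x y : K, edist x y ≤ R := fun x y => by
    rw [edist_dist, hRr]
    exact ENNReal.ofReal_le_ofReal (hr x y)
  obtain ⟨C, hCeq⟩ : ∃ C, C = R * M * M := ⟨_, rfl⟩
  have hC1 : 1 ≤ C := hCeq ▸ one_le_mul (one_le_mul hR1 hM1) hM1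
  have hCt : C ≠ ⊤ := hCeq ▸ ENNReal.mul_ne_top (ENNReal.mul_ne_top hRt hMt) hMt
  have hC0 : C ≠ 0 := (zero_lt_one.trans_le hC1).ne'
  obtain ⟨H, hHdef⟩ : ∃ H, H = weightKernel Q R M := ⟨_, rfl⟩
  have hH : ∀ x y : K, edist x y * weight Q x * weight Q y = C * expNeg (H (x, y)) := by
    rw [hCeq, hHdef]
    exact edist_mul_weight_eq hR0 hRt hM0 hMt hKR hwM
  have hlsc : LowerSemicontinuous H :=
    hHdef ▸ lowerSemicontinuous_weightKernel hQ.lowerSemicontinuous hR0 hM0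
  have hs : ∀ x y : K, H (x, y) = H (y, x) := hHdef ▸ weightKernel_comm Q R M
  have hm := hlsc.measurable
  obtain ⟨ρ, hρ⟩ := exists_weightKernel_energy_ne_top hQ.lowerSemicontinuous
    hQ.not_logPolar_finite hR1 hRt hM0 hMt hKR
  rw [← hHdef] at hρ
  have : Nonempty (ProbabilityMeasure K) := ⟨ρ⟩
  obtain ⟨μ, hμ⟩ := exists_kernelEnergy_eq_iInf hlsc
  obtain ⟨v, hv⟩ : ∃ v, v = ⨅ ρ : ProbabilityMeasure K, kernelEnergy H (ρ : Measure K) := ⟨_, rfl⟩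
  have hvt : v ≠ ⊤ := ne_top_of_le_ne_top hρ (hv ▸ iInf_le _ ρ)
  have hmin : minEnergy Q = (v : EReal) - ENNReal.log C := hv ▸ minEnergy_eq hH hm hC1 hCt hμ
  have hexp : EReal.exp (-minEnergy Q) = C * expNeg v := by rw [hmin, exp_neg_sub_log hCt]
  have huniq : ∀ μ' : ProbabilityMeasure K, kernelEnergy H (μ' : Measure K)
      = (⨅ ρ : ProbabilityMeasure K, kernelEnergy H (ρ : Measure K)) → μ' = μ := by
    intro μ' hμ'
    rw [← hv] at hμ hμ'
    have hmin' : ∀ ρ : ProbabilityMeasure K, v ≤ kernelEnergy H (ρ : Measure K) := fun ρ =>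
      hv ▸ iInf_le _ ρ
    have hHfun : H = fun p => logKernel R p + negLog (weight Q p.1 / M)
      + negLog (weight Q p.2 / M) := hHdef
    rw [hHfun] at hμ hμ' hmin'
    obtain ⟨h1, h2, h3⟩ := add_le_two_mul_of_minimizers (L := logKernel R)
      (q := fun x => negLog (weight Q x / M))
      (lowerSemicontinuous_negLog_weight hQ.lowerSemicontinuous hM0).measurable
      (logKernel_comm R) hvt hmin' (μ' : Measure K) (μ : Measure K) hμ' hμ
    rw [hRr] at h1 h2 h3
    have heq : (μ' : Measure K) = μ :=
      eq_of_logKernel_le hQ.isCompact.measurableSet hr0 hr _ _ h1 h2 h3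
    exact Subtype.ext heq
  have henergy : ∀ μ' : ProbabilityMeasure K, weightedEnergy Q (μ' : Measure K) = minEnergy Q ↔
      kernelEnergy H (μ' : Measure K) = v := by
    intro μ'
    rw [weightedEnergy_eq hH hm hC1 hCt, hmin]
    constructor
    · intro h
      -- Exponentiating avoids cancelling log C in the extended reals.
      have h2 := congrArg (fun e => EReal.exp (-e)) h
      simp only [exp_neg_sub_log hCt] at h2
      exact strictAnti_expNeg.injective ((ENNReal.mul_right_inj hC0 hCt).1 h2)
    · intro h
      rw [h]
  refine ⟨?_, μ, ⟨(henergy μ).2 (hv ▸ hμ), fun μ' hμ' => huniq μ' (hv ▸ (henergy μ').1 hμ')⟩, ?_⟩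
  -- The shift matches rows of k+1 points; the formula for the diameter needs at least two.
  · rw [hexp, ← tendsto_add_atTop_iff_nat 1]
    have h1 := tendsto_iInf_pairMean hlsc hs
    rw [← hv] at h1
    have h2 := ENNReal.Tendsto.const_mul ((continuous_expNeg.tendsto v).comp h1) (Or.inr hCt)
    refine h2.congr' ?_
    filter_upwards [eventually_ge_atTop 1] with k hk
    rw [diameter_eq hH (by omega)]
    rfl
  · intro ν _ hlim
    rw [hexp] at hlim
    have hprob : ∀ k : ℕ, IsProbabilityMeasure (vdmEnsemble Q ν (k + 1)) := fun k =>
      isProbabilityMeasure_vdmEnsemble ν _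
        (partitionFunction_ne_zero hH hm ν (mul_ne_zero hC0 (expNeg_ne_zero hvt)) hlim _)
        (partitionFunction_ne_top hH hCt ν _)
    refine ⟨hprob, ?_⟩
    -- Countably many levels decreasing to v give one almost sure event that works for every c > v.
    obtain ⟨u, -, hu, hulim⟩ := exists_seq_strictAnti_tendsto' hvt.lt_top
    have hae : ∀ᵐ Y ∂(arrayLaw Q ν), ∀ m, ∀ᶠ k in atTop, pairMean H (Y k) ≤ u m :=
      ae_all_iff.2 fun m => ae_eventually_pairMean_le hH hm hC0 hCt ν hvt hlim (hu m).1
    filter_upwards [hae] with Y hY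
    refine tendsto_empirical_of_unique hlsc hs huniq fun c hc => ?_
    rw [← hv] at hc
    obtain ⟨m, hm⟩ := (hulim.eventually (gt_mem_nhds hc)).exists
    filter_upwards [hY m] with k hk using hk.trans hm.le
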